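/- Let $R$ be a commutative principal ideal domain, $p\in R$ a prime element and $k=R/(p)$. A $p$-module is a finite length $R$-module annihilated by some power of $p$; its type is the partition $\beta$ whose conjugate is given by $\beta'_i=\dim_k p^{i-1}B/p^iB$ $(i\ge 1)$, pictured by the diagram with columns of length $\beta_j$, so that the $i$-th row has $\beta'_i$ boxes. Let $\mathcal S$ be the category of embeddings $E=(A\subset B)$ of $p$-modules (equivalently, of short exact sequences $0\to A\to B\to C\to 0$), where a morphism $(A\subset B)\to(A'\subset B')$ is an $R$-linear map $B\to B'$ sending $A$ into $A'$. Let $\mathcal S_2$ be the full subcategory of those $(A\subset B)$ with $p^2A=0$. For $E=(A\subset B)\in\mathcal S$, $\ell\ge 2$ and $r\ge 0$ let $\gamma^{\ell,r}$ be the type of $B/\bigl(p^\ell A+p(p^{\ell-2}A\cap p^rB)\bigr)$. In the Klein tableau of $E$, the boxes carrying the symbol $\ell_r$ $(r\ge 1)$ are those of the skew diagram $\gamma^{\ell,r}\setminus\gamma^{\ell,r-1}$. For $1\le r\le m-2$ let $T_2^{m,r}$ be the bipicket $\bigl(R\,(p^{m-2},p^{r-1})\subset R/(p^m)\oplus R/(p^r)\bigr)$,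 and let $T_2^{m,m-1}$ $(m\ge2)$ be the picket $P_2^m=\bigl((p^{m-2})\subset R/(p^m)\bigr)$. For $i\ge 0$ put $(A\subset B)\!\uparrow^i=(p^{-i}A\subset B)$ with $p^{-i}A=\{b\in B: p^ib\in A\}$, and for a morphism $v$ let $v\!\uparrow^i$ be the morphism between the lifted objects given by the same linear map. Let $E=(A\subset B)\in\mathcal S$ and let $\ell,m,r$ be natural numbers with $2\le\ell\le r+1\le m$. Then $T_2^{m,r}$ has a sink map (a minimal right almost split map) $v_2^{m,r}:Y\to T_2^{m,r}$ in $\mathcal S_2$, and for every such sink map the following three numbers are equal: 1. the number of boxes with symbol $\ell_r$ in the $m$-th row of the Klein tableau of $E$; 2. the multiplicity of $T_2^{m,r}$ in any decomposition into indecomposable direct summands of $E|_2^\ell=\bigl(p^{\ell-2}A/p^\ell A\subset B/p^\ell A\bigr)$ (and such a decomposition exists); 3. the $k$-dimension of $\operatorname{Hom}_{\mathcal S}(E,T_2^{m,r}\!\uparrow^{\ell-2})\big/\operatorname{Im}\operatorname{Hom}_{\mathcal S}(E,v_2^{m,r}\!\uparrow^{\ell-2})$, which is annihilated by $p$. -/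

import Mathlib

universe u

namespace Klein

section Modules

variable {R : Type u} [CommRing R] (p : R)

/-- A `p`-module: a finite length `R`-module annihilated by some power of `p`. -/
def IsPModule (M : Type u) [AddCommGroup M] [Module R M] : Prop :=
  IsFiniteLength R M ∧ ∃ n : ℕ, ∀ x : M, p ^ n • x = 0

variable {M : Type u} [AddCommGroup M] [Module R M]

/-- The submodule `p ^ i A` of `M`. -/
def powMul (i : ℕ) (A : Submodule R M) : Submodule R M :=
  A.map (LinearMap.lsmul R M (p ^ i))

/-- The submodule `p ^ (-i) A = {b | p ^ i b ∈ A}` of `M`. -/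
def powDiv (i : ℕ) (A : Submodule R M) : Submodule R M :=
  A.comap (LinearMap.lsmul R M (p ^ i))

/-- The residue ring `k = R / (p)`, a field when `p` generates a maximal ideal. -/
abbrev ResidueRing : Type u := R ⧸ Ideal.span {p}

variable (M) in
/-- For `i ≥ 1`, the `i`-th part `dim_k (p ^ (i - 1) M / p ^ i M)` of the conjugate of the
type of `M`.  Here `p ^ i M` is `p` times `N = p ^ (i - 1) M`, so the quotient is `N / (p) N`. -/
noncomputable def conjType (i : ℕ) : ℕ :=
  Module.finrank (ResidueRing p)
    (powMul p (i - 1) (⊤ : Submodule R M) ⧸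
      (Ideal.span {p} • (⊤ : Submodule R (powMul p (i - 1) (⊤ : Submodule R M)))))

variable (M) in
/-- The diagram of the partition `type M`, as a set of boxes `(row, column)`, both numbered
from `1`.  The parts of the partition are the lengths of the columns; the length of row `i`
is the `i`-th part of the conjugate partition. -/
def typeDiagram : Set (ℕ × ℕ) :=
  {b | 1 ≤ b.1 ∧ 1 ≤ b.2 ∧ b.2 ≤ conjType p M b.1}

end Modules

/-- An embedding `(A ⊂ B)` of a submodule into an `R`-module; it stands for the short exact
sequence `0 → A → B → B / A → 0`. -/
structure Emb (R : Type u) [CommRing R] : Type (u + 1) where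
  /-- the ambient module -/
  B : Type u
  [grp : AddCommGroup B]
  [mod : Module R B]
  /-- the submodule -/
  A : Submodule R B

attribute [instance] Emb.grp Emb.mod

namespace Emb

variable {R : Type u} [CommRing R] (p : R)

/-- The objects of `S`: embeddings of `p`-modules. -/
def InS (E : Emb R) : Prop := IsPModule p E.B

/-- The objects of `S_2`: embeddings of `p`-modules with `p ^ 2 A = 0`. -/
def InS2 (E : Emb R) : Prop := E.InS p ∧ ∀ a ∈ E.A, p ^ 2 • a = 0

/-- Morphisms `(A ⊂ B) → (A' ⊂ B')` form the `R`-module of linear maps `B → B'` that send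
`A` into `A'`. -/
def Hom (E F : Emb R) : Submodule R (E.B →ₗ[R] F.B) where
  carrier := {f | ∀ a ∈ E.A, f a ∈ F.A}
  add_mem' hf hg a ha := F.A.add_mem (hf a ha) (hg a ha)
  zero_mem' _ _ := F.A.zero_mem
  smul_mem' c _ hf a ha := F.A.smul_mem c (hf a ha)

/-- Composition with a fixed morphism `v : Y → Z`, as a linear map
`Hom(E, Y) → Hom(E, Z)`. -/
def homMap (E : Emb R) {Y Z : Emb R} (v : Hom Y Z) : Hom E Y →ₗ[R] Hom E Z where
  toFun f := ⟨v.1 ∘ₗ f.1, fun a ha => v.2 _ (f.2 a ha)⟩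
  map_add' f g := Subtype.ext (LinearMap.comp_add f.1 g.1 v.1)
  map_smul' c f := Subtype.ext (LinearMap.comp_smul v.1 c f.1)

/-- The identity morphism. -/
def idHom (E : Emb R) : Hom E E := ⟨LinearMap.id, fun _ ha => ha⟩

/-- Isomorphism of embeddings. -/
def Iso (E F : Emb R) : Prop :=
  ∃ e : E.B ≃ₗ[R] F.B, E.A.map e.toLinearMap = F.A

/-- The direct sum of a finite family of embeddings. -/
abbrev directSum {n : ℕ} (X : Fin n → Emb R) : Emb R where
  B := ∀ i, (X i).B
  A := Submodule.pi Set.univ fun i => (X i).A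

/-- An indecomposable embedding: nonzero, and not a direct sum of two nonzero embeddings. -/
def Indecomposable (E : Emb R) : Prop :=
  Nontrivial E.B ∧ ∀ X : Fin 2 → Emb R, Iso E (directSum X) →
    Subsingleton (X 0).B ∨ Subsingleton (X 1).B

/-- `E` is the direct sum of the indecomposable embeddings `X i`. -/
def IsDecomposition (E : Emb R) {n : ℕ} (X : Fin n → Emb R) : Prop :=
  (∀ i, Indecomposable (X i)) ∧ Iso E (directSum X)

/-- `N` is the multiplicity of `T` as a direct summand of `E`: `E` has decompositions into
indecomposables, and each of them has exactly `N` terms isomorphic to `T`. -/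
def HasMultiplicity (E T : Emb R) (N : ℕ) : Prop :=
  (∃ (n : ℕ) (X : Fin n → Emb R), IsDecomposition E X) ∧
    ∀ (n : ℕ) (X : Fin n → Emb R), IsDecomposition E X → {i | Iso (X i) T}.ncard = N

/-- The picket `P_ℓ^m = ((p ^ (m - ℓ)) ⊂ R / (p ^ m))`, for `ℓ ≤ m`. -/
abbrev picket (ℓ m : ℕ) : Emb R where
  B := R ⧸ Ideal.span {p ^ m}
  A := Submodule.span R {Ideal.Quotient.mk _ (p ^ (m - ℓ))}

/-- The object `T_2^{m,r}`, for `1 ≤ r ≤ m - 1`.  For `r ≤ m - 2` it is the bipicket, the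
cyclic submodule generated by `(p ^ (m - 2), p ^ (r - 1))` in `R / (p ^ m) ⊕ R / (p ^ r)`;
for `r = m - 1` it is the picket `P_2^m`. -/
def bipicket (m r : ℕ) : Emb R :=
  if r + 1 = m then picket p 2 m
  else
    { B := (R ⧸ Ideal.span {p ^ m}) × (R ⧸ Ideal.span {p ^ r})
      A := Submodule.span R
        {(Ideal.Quotient.mk _ (p ^ (m - 2)), Ideal.Quotient.mk _ (p ^ (r - 1)))} }

/-- The lifting `(p ^ (-i) A ⊂ B)` of `(A ⊂ B)`. -/
abbrev lift (i : ℕ) (E : Emb R) : Emb R where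
  B := E.B
  A := powDiv p i E.A

/-- The lifting of a morphism; the underlying map does not change. -/
def liftHom (i : ℕ) {E F : Emb R} (v : Hom E F) : Hom (lift p i E) (lift p i F) :=
  ⟨v.1, fun (a : E.B) (ha : p ^ i • a ∈ E.A) =>
    show p ^ i • v.1 a ∈ F.A from map_smul v.1 (p ^ i) a ▸ v.2 _ ha⟩

/-- The subfactor `(p ^ (ℓ - 2) A / p ^ ℓ A ⊂ B / p ^ ℓ A)` of `(A ⊂ B)`, for `ℓ ≥ 2`. -/
abbrev subfactor (ℓ : ℕ) (E : Emb R) : Emb R where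
  B := E.B ⧸ powMul p ℓ E.A
  A := (powMul p (ℓ - 2) E.A).map (powMul p ℓ E.A).mkQ

/-- The diagram of `type (B / (p ^ ℓ A + p (p ^ (ℓ - 2) A ∩ p ^ r B)))`, for `ℓ ≥ 2`. -/
def kleinDiagram (E : Emb R) (ℓ r : ℕ) : Set (ℕ × ℕ) :=
  typeDiagram p
    (E.B ⧸ (powMul p ℓ E.A ⊔ powMul p 1 (powMul p (ℓ - 2) E.A ⊓ powMul p r ⊤)))

/-- The boxes which carry the symbol `ℓ_r` (entry `ℓ ≥ 2`, subscript `r ≥ 1`) in the Klein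
tableau of `E`. -/
def kleinBoxes (E : Emb R) (ℓ r : ℕ) : Set (ℕ × ℕ) :=
  kleinDiagram p E ℓ r \ kleinDiagram p E ℓ (r - 1)

/-- The number of symbols `ℓ_r` in row `m` of the Klein tableau of `E`. -/
noncomputable def kleinCount (E : Emb R) (ℓ r m : ℕ) : ℕ :=
  {b ∈ kleinBoxes p E ℓ r | b.1 = m}.ncard

/-- The morphism `f` is a split epimorphism. -/
def IsSplitEpimorphism {X Z : Emb R} (f : Hom X Z) : Prop :=
  ∃ s : Hom Z X, homMap Z f s = idHom Z

/-- The morphism `g : Y → Y` is an automorphism. -/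
def IsAutomorphism {Y : Emb R} (g : Hom Y Y) : Prop :=
  ∃ h : Hom Y Y, homMap Y g h = idHom Y ∧ homMap Y h g = idHom Y

/-- The morphism `v : Y → Z` is a sink map (minimal right almost split map) in `S_2`: both
objects lie in `S_2`, `v` is not a split epimorphism, each morphism in `S_2` with target `Z`
that is not a split epimorphism factors through `v`, and each endomorphism `g` of `Y` with
`v g = v` is an automorphism. -/
structure IsSinkMap {Y Z : Emb R} (v : Hom Y Z) : Prop where
  source_mem : Y.InS2 p
  target_mem : Z.InS2 p
  not_split : ¬ IsSplitEpimorphism v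
  factors : ∀ (X : Emb R), X.InS2 p → ∀ f : Hom X Z, ¬ IsSplitEpimorphism f →
    ∃ g : Hom X Y, homMap X v g = f
  minimal : ∀ g : Hom Y Y, homMap Y v g = v → IsAutomorphism g

/-- The quotient `Hom(E, Z) / Im Hom(E, v)` for `v : Y → Z`. -/
abbrev Defect (E : Emb R) {Y Z : Emb R} (v : Hom Y Z) : Type u :=
  Hom E Z ⧸ LinearMap.range (homMap E v)

end Emb

/-- The `R`-module `M` is annihilated by `p`, and as a vector space over `k = R / (p)` it has
dimension `N`. -/
def HasResidueDim {R : Type u} [CommRing R] (p : R) (M : Type u) [AddCommGroup M] [Module R M]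
    (N : ℕ) : Prop :=
  ∃ h : Module.IsTorsionBySet R M (Ideal.span {p} : Ideal R),
    @Module.rank (ResidueRing p) M _ _ h.module = (N : Cardinal.{u})

end Klein

/-!
Write `T` for the object `T_2^{m,r}`, `a` for the generator of its submodule and `t = p a`; this is
the socle element `(p ^ (m - 1), 0)`, or `p ^ (m - 1)` if `T` is a picket.  The proof does not use
the classification of the indecomposable objects of `S_2`.

A morphism `f` from an object `X = (A ⊂ B)` of `S_2` to `T` acts on `p A` as a functional
`ψ : p A → R / (p)` times `t`, and `ψ` vanishes on `p A ∩ p ^ m B` and on `p (A ∩ p ^ r B)`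
(it is `Admissible`).  Conversely every such functional comes from a morphism, because
`R / (p ^ n)` is self-injective (`exists_extend`, `IsModel.exists_hom`).  Dually, the images of `t`
under the morphisms `T → X` fill the submodule `socleTrace = p (A ∩ p ^ (r - 1) B) ∩ p ^ (m - 1) B`
(`IsModel.exists_hom_from`), and an endomorphism of `T` that does not annihilate `t` is an
automorphism.  Hence `f` is a split epimorphism if and only if it does not vanish on `socleTrace`
(`IsModel.isSplitEpimorphism_iff`), and the morphisms that do vanish on it form a submodule, the
`radical`; it is the image of `Hom(X, v)` for every sink map `v` (`IsModel.range_homMap`).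

Existence of a sink map: if `f` lies in the radical, then `ψ` vanishes on the intersection of
`p (A ∩ p ^ (r - 1) B) + (p A ∩ p ^ m B)` and `p A ∩ p ^ (m - 1) B`, so it is a sum of two
functionals that are admissible of level `(m, r - 1)` and `(m - 1, r)`.  If nonzero, these are
realized through the objects `cyclicPair` of the same level, and the remainder of `f` annihilates
`p A`, so that it sends `A` into the multiples of `t`.  This yields a right almost split map, and one
with a source of minimal length is a sink map.

The quotient of `Hom(X, T)` by the radical is computed in two ways.  It is dual to the image of
`socleTrace` in `B / (p (A ∩ p ^ r B) + p ^ m B)`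
(`IsModel.nonempty_equiv_of_length_socleQuotient`), whose length is the difference of two conjugate
parts that counts the boxes of the Klein tableau (`length_socleQuotient_subfactor`).  On the other
hand, in a decomposition of `X` exactly the summands isomorphic to `T` contribute, one dimension
each (`IsModel.nonempty_equiv_of_isDecomposition`).

The case of an arbitrary `ℓ` reduces to that of `ℓ = 2` because `Hom(E, Z↑^(ℓ - 2))` is
`Hom(F, Z)` for the subfactor `F` of `E` and every `Z` in `S_2` (`subfactorHom_bijective`), and
because the quotients of `B` that define the Klein diagrams are quotients of the ambient module of
`F` (`ker_factor_subfactor`).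
-/

/-! ### Modules over `R / (p ^ n)` -/

namespace Klein

section Algebra

variable {R : Type u} [CommRing R] [IsDomain R] {p : R}

theorem mk_pow_mul_eq_zero_iff (hp : Prime p) {i n : ℕ} (hi : i ≤ n) (s : R) :
    Ideal.Quotient.mk (Ideal.span {p ^ n}) (p ^ i * s) = 0 ↔ p ^ (n - i) ∣ s := by
  rw [Ideal.Quotient.eq_zero_iff_mem, Ideal.mem_span_singleton, ← Nat.add_sub_cancel' hi, pow_add,
    mul_dvd_mul_iff_left (pow_ne_zero _ hp.ne_zero), Nat.add_sub_cancel_left]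

variable [IsPrincipalIdealRing R]

theorem isMaximal_span (hp : Prime p) : (Ideal.span {p}).IsMaximal :=
  PrincipalIdealRing.isMaximal_of_irreducible hp.irreducible

/-- The ring `R / (p ^ n)` is self-injective. -/
theorem baer_quotient_pow (hp : Prime p) (n : ℕ) :
    Module.Baer (R ⧸ Ideal.span {p ^ n}) (R ⧸ Ideal.span {p ^ n}) := by
  intro I g
  obtain ⟨d, hd⟩ := IsPrincipalIdealRing.principal
    (I.comap (Ideal.Quotient.mk (Ideal.span {p ^ n})))
  have hd' : ∀ x : R, Ideal.Quotient.mk (Ideal.span {p ^ n}) x ∈ I ↔ d ∣ x := fun x => by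
    rw [← Ideal.mem_comap, hd, ← Ideal.mem_span_singleton]
  have hdn : d ∣ p ^ n := by
    rw [← hd', Ideal.Quotient.eq_zero_iff_mem.2 (Ideal.mem_span_singleton_self _)]
    exact I.zero_mem
  obtain ⟨i, hi, hdi⟩ := (dvd_prime_pow hp n).1 hdn
  have hI : ∀ x : R, Ideal.Quotient.mk (Ideal.span {p ^ n}) x ∈ I ↔ p ^ i ∣ x := fun x => by
    rw [hd', hdi.dvd_iff_dvd_left]
  obtain ⟨s, hs⟩ := Ideal.Quotient.mk_surjective (g ⟨_, (hI (p ^ i)).2 dvd_rfl⟩)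
  have hs0 : Ideal.Quotient.mk (Ideal.span {p ^ n}) (p ^ (n - i) * s) = 0 := by
    rw [map_mul, hs, ← smul_eq_mul, ← map_smul]
    convert map_zero g
    refine Subtype.ext ?_
    change Ideal.Quotient.mk (Ideal.span {p ^ n}) (p ^ (n - i)) * Ideal.Quotient.mk _ (p ^ i) = 0
    rw [← map_mul, ← pow_add, Nat.sub_add_cancel hi, Ideal.Quotient.eq_zero_iff_mem]
    exact Ideal.mem_span_singleton_self _
  -- As `p ^ (n - i)` annihilates the image `s` of the generator `p ^ i`, `p ^ i` divides `s`.
  rw [mk_pow_mul_eq_zero_iff hp (Nat.sub_le _ _), Nat.sub_sub_self hi] at hs0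
  obtain ⟨t, rfl⟩ := hs0
  refine ⟨LinearMap.toSpanSingleton _ _ (Ideal.Quotient.mk _ t), fun x hx => ?_⟩
  obtain ⟨x, rfl⟩ := Ideal.Quotient.mk_surjective x
  obtain ⟨c, rfl⟩ := (hI x).1 hx
  have : (⟨Ideal.Quotient.mk _ (p ^ i * c), hx⟩ : I) =
      Ideal.Quotient.mk (Ideal.span {p ^ n}) c • ⟨_, (hI (p ^ i)).2 dvd_rfl⟩ :=
    Subtype.ext ((map_mul _ _ _).trans (mul_comm _ _))
  rw [this, map_smul, ← hs, LinearMap.toSpanSingleton_apply, smul_eq_mul, smul_eq_mul, ← map_mul,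
    ← map_mul]
  congr 1; ring

/-- A linear map from a submodule `A` of `M` to `R / (p ^ n)` that vanishes on `A ∩ C` extends to a
linear map on `M` that vanishes on `C`, as soon as `p ^ n` annihilates `M / C`. -/
theorem exists_extend (hp : Prime p) {M : Type*} [AddCommGroup M] [Module R M] {n : ℕ}
    {A C : Submodule R M} (f : A →ₗ[R] R ⧸ Ideal.span {p ^ n}) (hC : ∀ x : M, p ^ n • x ∈ C)
    (hf : ∀ x : A, (x : M) ∈ C → f x = 0) :
    ∃ g : M →ₗ[R] R ⧸ Ideal.span {p ^ n}, (∀ x : A, g x = f x) ∧ ∀ x ∈ C, g x = 0 := by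
  let φ : A →ₗ[R] M ⧸ C := C.mkQ ∘ₗ A.subtype
  have hφ : ∀ x : A, φ x = 0 ↔ (x : M) ∈ C := fun x => Submodule.Quotient.mk_eq_zero C
  let i : (A ⧸ φ.ker) →ₗ[R] M ⧸ C := φ.ker.liftQ φ le_rfl
  have hi : Function.Injective i := LinearMap.ker_eq_bot.1 (Submodule.ker_liftQ_eq_bot' _ _ rfl)
  let f' : (A ⧸ φ.ker) →ₗ[R] R ⧸ Ideal.span {p ^ n} :=
    φ.ker.liftQ f fun x hx => hf x ((hφ x).1 hx)
  have hM : Module.IsTorsionBySet R (M ⧸ C) (Ideal.span {p ^ n} : Ideal R) := by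
    refine (Module.isTorsionBySet_span_singleton_iff _).2 fun x => ?_
    obtain ⟨x, rfl⟩ := C.mkQ_surjective x
    rw [← map_smul]
    exact (Submodule.Quotient.mk_eq_zero C).2 (hC x)
  have hP : Module.IsTorsionBySet R (A ⧸ φ.ker) (Ideal.span {p ^ n} : Ideal R) := fun x a =>
    hi (by rw [map_smul, map_zero]; exact @hM (i x) a)
  let := hM.module
  let := hP.module
  have hsurj : Function.Surjective (algebraMap R (R ⧸ Ideal.span {p ^ n})) :=
    Ideal.Quotient.mk_surjective
  obtain ⟨h, hh⟩ := (baer_quotient_pow hp n).extension_property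
    (LinearMap.extendScalarsOfSurjective hsurj i) hi (LinearMap.extendScalarsOfSurjective hsurj f')
  refine ⟨h.restrictScalars R ∘ₗ C.mkQ, fun x => ?_, fun x hx => ?_⟩
  · exact LinearMap.congr_fun hh (φ.ker.mkQ x)
  · rw [LinearMap.comp_apply, Submodule.mkQ_apply, (Submodule.Quotient.mk_eq_zero C).2 hx,
      map_zero]

/-- The case `n = 1` of `exists_extend`. -/
theorem exists_extend_residue (hp : Prime p) {M : Type*} [AddCommGroup M] [Module R M]
    {A C : Submodule R M} (f : A →ₗ[R] ResidueRing p) (hC : ∀ x : M, p • x ∈ C)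
    (hf : ∀ x : A, (x : M) ∈ C → f x = 0) :
    ∃ g : M →ₗ[R] ResidueRing p, (∀ x : A, g x = f x) ∧ ∀ x ∈ C, g x = 0 := by
  have h := exists_extend hp (M := M) (n := 1) (A := A) (C := C)
  rw [pow_one] at h
  exact h f hC hf

/-- On a module annihilated by `p`, a functional that vanishes on an intersection of two submodules
is a sum of two functionals, each vanishing on one of them. -/
theorem exists_add_of_inf (hp : Prime p) {M : Type*} [AddCommGroup M] [Module R M]
    (hM : ∀ x : M, p • x = 0) (M₁ M₂ : Submodule R M) (ψ : M →ₗ[R] ResidueRing p)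
    (h : ∀ x ∈ M₁, x ∈ M₂ → ψ x = 0) :
    ∃ ψ₁ ψ₂ : M →ₗ[R] ResidueRing p,
      ψ = ψ₁ + ψ₂ ∧ (∀ x ∈ M₁, ψ₁ x = 0) ∧ ∀ x ∈ M₂, ψ₂ x = 0 := by
  obtain ⟨g, hg₂, hg₁⟩ := exists_extend_residue hp (A := M₂) (C := M₁) (ψ ∘ₗ M₂.subtype)
    (fun x => by rw [hM]; exact M₁.zero_mem) (fun x hx => h x hx x.2)
  refine ⟨g, ψ - g, by abel, hg₁, fun x hx => ?_⟩
  rw [LinearMap.sub_apply, hg₂ ⟨x, hx⟩]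
  exact sub_self _

theorem isFiniteLength_quotient_pow (hp : Prime p) (n : ℕ) :
    IsFiniteLength R (R ⧸ Ideal.span {p ^ n}) :=
  isFiniteLength_quotient_span_singleton R
    (mem_nonZeroDivisors_of_ne_zero (pow_ne_zero n hp.ne_zero))

theorem length_residueRing (hp : Prime p) : Module.length R (ResidueRing p) = 1 := by
  have := isMaximal_span hp
  rw [Module.length_eq_one_iff, isSimpleModule_iff_isCoatom]
  exact Ideal.isMaximal_def.1 this

theorem length_residueRing_pi (hp : Prime p) (ι : Type*) [Fintype ι] :
    Module.length R (ι → ResidueRing p) = Fintype.card ι := by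
  rw [Module.length_pi, length_residueRing hp, ENat.card_eq_coe_fintype_card, mul_one]

theorem hasResidueDim_of_equiv (hp : Prime p) {M : Type u} [AddCommGroup M] [Module R M]
    {ι : Type} [Fintype ι] (e : M ≃ₗ[R] (ι → ResidueRing p)) :
    HasResidueDim p M (Fintype.card ι) := by
  have hk : ∀ x : ResidueRing p, p • x = 0 := fun x => by
    obtain ⟨x, rfl⟩ := Ideal.Quotient.mk_surjective x
    exact Ideal.Quotient.eq_zero_iff_mem.2
      (Ideal.mul_mem_right _ _ (Ideal.mem_span_singleton_self p))
  have hM : Module.IsTorsionBySet R M (Ideal.span {p} : Ideal R) := by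
    refine (Module.isTorsionBySet_span_singleton_iff _).2 fun x => e.injective ?_
    rw [map_smul, map_zero]
    exact funext fun i => hk _
  refine ⟨hM, ?_⟩
  let := hM.module
  have := isMaximal_span hp
  have e' : M ≃ₗ[ResidueRing p] (ι → ResidueRing p) :=
    LinearEquiv.extendScalarsOfSurjective (Ideal.Quotient.mk_surjective) e
  exact e'.rank_eq.trans rank_fun'

/-- Over `R`, a finite length module annihilated by `p` is a coordinate space over `R / (p)`. -/
theorem nonempty_equiv_of_length (hp : Prime p) {M : Type*} [AddCommGroup M] [Module R M]
    (hM : ∀ x : M, p • x = 0) {N : ℕ} (hN : Module.length R M = N) :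
    Nonempty (M ≃ₗ[R] (Fin N → ResidueRing p)) := by
  have := isMaximal_span hp
  let : Field (ResidueRing p) := Ideal.Quotient.field _
  have hM : Module.IsTorsionBySet R M (Ideal.span {p} : Ideal R) :=
    (Module.isTorsionBySet_span_singleton_iff _).2 fun x => hM x
  let := hM.module
  have hl := Module.length_eq_of_surjective (R := ResidueRing p) (S := R) (M := M)
    Ideal.Quotient.mk_surjective
  have hfin : IsFiniteLength (ResidueRing p) M :=
    Module.length_ne_top_iff.1 (by rw [← hl, hN]; exact ENat.natCast_ne_top N)
  have := (isFiniteLength_iff_isNoetherian_isArtinian.1 hfin).1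
  rw [hN, Module.length_eq_finrank] at hl
  have hl' : N = Module.finrank (ResidueRing p) M := by exact_mod_cast hl
  exact ⟨(Module.finBasisOfFinrankEq _ _ hl'.symm).equivFun.restrictScalars R⟩

theorem finrank_eq_length (hp : Prime p) {M : Type*} [AddCommGroup M] [Module R M]
    [Module (ResidueRing p) M] [IsScalarTower R (ResidueRing p) M] (hM : IsFiniteLength R M) :
    (Module.finrank (ResidueRing p) M : ℕ∞) = Module.length R M := by
  have := isMaximal_span hp
  let : Field (ResidueRing p) := Ideal.Quotient.field _
  have hl := Module.length_eq_of_surjective (R := ResidueRing p) (S := R) (M := M)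
    Ideal.Quotient.mk_surjective
  have hfin : IsFiniteLength (ResidueRing p) M :=
    Module.length_ne_top_iff.1 (by rw [← hl]; exact Module.length_ne_top_iff.2 hM)
  have := (isFiniteLength_iff_isNoetherian_isArtinian.1 hfin).1
  rw [hl, Module.length_eq_finrank]

end Algebra

end Klein

/-! ### Morphisms to the embedding of a cyclic module -/

namespace Klein

section PowMul

variable {R : Type u} [CommRing R] {p : R} {M : Type u} [AddCommGroup M] [Module R M]

theorem powMul_top_antitone {i j : ℕ} (h : i ≤ j) :
    powMul p j (⊤ : Submodule R M) ≤ powMul p i ⊤ := by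
  rintro _ ⟨x, -, rfl⟩
  refine ⟨p ^ (j - i) • x, trivial, ?_⟩
  rw [LinearMap.lsmul_apply, LinearMap.lsmul_apply, smul_smul, ← pow_add, Nat.add_sub_cancel' h]

/-- A linear map on a `p`-torsion module is injective if it is injective on the socle. -/
theorem injective_of_socle {N : Type*} [AddCommGroup N] [Module R N] {n : ℕ}
    (hM : ∀ x : M, p ^ n • x = 0) (f : M →ₗ[R] N) (hf : ∀ z, p • z = 0 → f z = 0 → z = 0) :
    Function.Injective f := by
  have key : ∀ (n : ℕ) (x : M), p ^ n • x = 0 → f x = 0 → x = 0 := by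
    intro n
    induction n with
    | zero => intro x hx _; simpa using hx
    | succ n ih =>
      intro x hx hfx
      refine hf x (ih (p • x) ?_ ?_) hfx
      · rwa [smul_smul, ← pow_succ]
      · rw [map_smul, hfx, smul_zero]
  exact (injective_iff_map_eq_zero f).2 fun x hx => key n x (hM x) hx

end PowMul

namespace Emb

section Basic

variable {R : Type u} [CommRing R] {p : R}

theorem map_mem_powMul {M N : Type u} [AddCommGroup M] [Module R M] [AddCommGroup N] [Module R N]
    (f : M →ₗ[R] N) {i : ℕ} {x : M} (hx : x ∈ powMul p i (⊤ : Submodule R M)) :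
    f x ∈ powMul p i (⊤ : Submodule R N) := by
  obtain ⟨y, -, rfl⟩ := hx
  exact ⟨f y, trivial, (map_smul f _ y).symm⟩

/-- A bijective endomorphism of a finite length embedding restricts to an injective, hence
bijective, endomorphism of the submodule, so that its inverse is a morphism. -/
theorem isAutomorphism_of_bijective {Y : Emb R} (hY : IsFiniteLength R Y.B) (h : Hom Y Y)
    (hb : Function.Bijective h.1) : IsAutomorphism h := by
  obtain ⟨_, _⟩ := isFiniteLength_iff_isNoetherian_isArtinian.1 hY
  let e := LinearEquiv.ofBijective h.1 hb
  have hA : Function.Surjective (h.1.restrict h.2) :=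
    (IsArtinian.bijective_of_injective_endomorphism (h.1.restrict h.2) fun x y hxy =>
      Subtype.ext (hb.1 (congrArg Subtype.val hxy))).2
  refine ⟨⟨e.symm.toLinearMap, fun a ha => ?_⟩, Subtype.ext (LinearMap.ext fun x => ?_),
    Subtype.ext (LinearMap.ext fun x => ?_)⟩
  · obtain ⟨b, hb'⟩ := hA ⟨a, ha⟩
    have : e.symm a = b := (LinearEquiv.symm_apply_eq e).2 (congrArg Subtype.val hb').symm
    exact this ▸ b.2
  · exact e.apply_symm_apply x
  · exact e.symm_apply_apply x

theorem isAutomorphism_of_injective {Y : Emb R} (hY : IsFiniteLength R Y.B) (h : Hom Y Y)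
    (hb : Function.Injective h.1) : IsAutomorphism h := by
  obtain ⟨_, _⟩ := isFiniteLength_iff_isNoetherian_isArtinian.1 hY
  exact isAutomorphism_of_bijective hY h (IsArtinian.bijective_of_injective_endomorphism _ hb)

theorem isAutomorphism_of_surjective {Y : Emb R} (hY : IsFiniteLength R Y.B) (h : Hom Y Y)
    (hb : Function.Surjective h.1) : IsAutomorphism h := by
  obtain ⟨_, _⟩ := isFiniteLength_iff_isNoetherian_isArtinian.1 hY
  exact isAutomorphism_of_bijective hY h
    (IsNoetherian.bijective_of_surjective_endomorphism _ hb)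

variable (p) in
/-- A functional `ψ : p A → R / (p)` is admissible of level `(m, r)` if it vanishes on
`p A ∩ p ^ m B` and on `p (A ∩ p ^ r B)`.  Every morphism from `(A ⊂ B)` to the bipicket
`T_2^{m,r}` induces such a functional. -/
def Admissible (m r : ℕ) {X : Emb R} (ψ : powMul p 1 X.A →ₗ[R] ResidueRing p) : Prop :=
  (∀ y : powMul p 1 X.A, (y : X.B) ∈ powMul p m (⊤ : Submodule R X.B) → ψ y = 0) ∧
    ∀ y : powMul p 1 X.A, (y : X.B) ∈ powMul p 1 (X.A ⊓ powMul p r ⊤) → ψ y = 0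

/-- The linear map `f` acts on `p A` as the functional `ψ` times the element `t`. -/
def Realizes {X : Emb R} {N : Type u} [AddCommGroup N] [Module R N] (t : N) (f : X.B →ₗ[R] N)
    (ψ : powMul p 1 X.A →ₗ[R] ResidueRing p) : Prop :=
  ∀ (y : powMul p 1 X.A) (w : R), ψ y = Ideal.Quotient.mk _ w → f y = w • t

variable (p) in
/-- The embedding of the cyclic submodule generated by `(p ^ (m - 2), p ^ (r - 1))` in
`R / (p ^ m) ⊕ R / (p ^ r)`.  It is the bipicket `T_2^{m,r}` if `1 ≤ r ≤ m - 2`; the other values of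
`r` occur in the source of the right almost split map. -/
abbrev cyclicPair (m r : ℕ) : Emb R where
  B := (R ⧸ Ideal.span {p ^ m}) × (R ⧸ Ideal.span {p ^ r})
  A := Submodule.span R
        {(Ideal.Quotient.mk _ (p ^ (m - 2)), Ideal.Quotient.mk _ (p ^ (r - 1)))}

variable (p) in
/-- Multiplication by `p ^ (n - 1)`, as a linear map `R / (p) → R / (p ^ n)`. -/
def socleMap (n : ℕ) : ResidueRing p →ₗ[R] R ⧸ Ideal.span {p ^ n} :=
  Submodule.liftQ (Ideal.span {p})
    (LinearMap.toSpanSingleton R _ (Ideal.Quotient.mk (Ideal.span {p ^ n}) (p ^ (n - 1)))) (by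
      rw [Ideal.span_le, Set.singleton_subset_iff]
      change Ideal.Quotient.mk (Ideal.span {p ^ n}) (p * p ^ (n - 1)) = 0
      rw [Ideal.Quotient.eq_zero_iff_mem, Ideal.mem_span_singleton, ← pow_succ']
      exact pow_dvd_pow p (by omega))

theorem socleMap_mk (n : ℕ) (w : R) :
    socleMap p n (Ideal.Quotient.mk _ w) = Ideal.Quotient.mk _ (w * p ^ (n - 1)) := rfl

theorem mk_smul_mk {n : ℕ} (c s : R) :
    c • Ideal.Quotient.mk (Ideal.span {p ^ n}) s = Ideal.Quotient.mk _ (c * s) := rfl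

theorem pow_smul_quotient {n i : ℕ} (h : n ≤ i) (x : R ⧸ Ideal.span {p ^ n}) : p ^ i • x = 0 := by
  obtain ⟨x, rfl⟩ := Ideal.Quotient.mk_surjective x
  rw [mk_smul_mk, Ideal.Quotient.eq_zero_iff_mem, Ideal.mem_span_singleton]
  exact (pow_dvd_pow p h).mul_right x

end Basic

section Prime

variable {R : Type u} [CommRing R] [IsDomain R] {p : R}

theorem mk_mul_pow_eq_zero_iff (hp : Prime p) {i n : ℕ} (hi : i ≤ n) (s : R) :
    Ideal.Quotient.mk (Ideal.span {p ^ n}) (s * p ^ i) = 0 ↔ p ^ (n - i) ∣ s := by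
  rw [mul_comm, mk_pow_mul_eq_zero_iff hp hi]

theorem mk_mul_pow_pred_eq_zero_iff (hp : Prime p) {n : ℕ} (hn : 1 ≤ n) (s : R) :
    Ideal.Quotient.mk (Ideal.span {p ^ n}) (s * p ^ (n - 1)) = 0 ↔ p ∣ s := by
  rw [mk_mul_pow_eq_zero_iff hp (Nat.sub_le _ _), Nat.sub_sub_self hn, pow_one]

theorem exists_eq_of_pow_smul (hp : Prime p) {i n : ℕ} (hi : i ≤ n)
    {x : R ⧸ Ideal.span {p ^ n}} (hx : p ^ i • x = 0) :
    ∃ s, x = Ideal.Quotient.mk _ (s * p ^ (n - i)) := by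
  obtain ⟨x, rfl⟩ := Ideal.Quotient.mk_surjective x
  rw [mk_smul_mk, mk_pow_mul_eq_zero_iff hp hi] at hx
  obtain ⟨s, rfl⟩ := hx
  exact ⟨s, by rw [mul_comm]⟩

theorem socleMap_injective (hp : Prime p) {n : ℕ} (hn : 1 ≤ n) :
    Function.Injective (socleMap p n) := by
  refine (injective_iff_map_eq_zero _).2 fun x hx => ?_
  obtain ⟨x, rfl⟩ := Ideal.Quotient.mk_surjective x
  rw [socleMap_mk, mk_mul_pow_pred_eq_zero_iff hp hn] at hx
  exact Ideal.Quotient.eq_zero_iff_mem.2 (Ideal.mem_span_singleton.2 hx)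

end Prime

section Coordinates

variable {R : Type u} [CommRing R] [IsDomain R] [IsPrincipalIdealRing R] {p : R}

/-- The first coordinate of a morphism to a bipicket with a prescribed action on `p A`.  Since
`p ^ 2 A = 0`, any extension of `ψ` to `B → R / (p ^ m)` sends `A` into the multiples of
`p ^ (m - 2)`. -/
theorem exists_first_coordinate (hp : Prime p) {m : ℕ} (hm : 2 ≤ m) {X : Emb R}
    (hX : ∀ a ∈ X.A, p ^ 2 • a = 0) (ψ : powMul p 1 X.A →ₗ[R] ResidueRing p)
    (hψ : ∀ y : powMul p 1 X.A, (y : X.B) ∈ powMul p m (⊤ : Submodule R X.B) → ψ y = 0) :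
    ∃ f : X.B →ₗ[R] R ⧸ Ideal.span {p ^ m},
      (∀ y : powMul p 1 X.A, f y = socleMap p m (ψ y)) ∧
      ∀ (a : X.B) (ha : a ∈ X.A), ∃ w : R, f a = Ideal.Quotient.mk _ (w * p ^ (m - 2)) ∧
        ψ ⟨p ^ 1 • a, a, ha, rfl⟩ = Ideal.Quotient.mk _ w := by
  obtain ⟨f, hf, -⟩ := exists_extend hp (A := powMul p 1 X.A) (C := powMul p m ⊤)
    (socleMap p m ∘ₗ ψ) (fun x => ⟨x, trivial, rfl⟩)
    (fun y hy => by rw [LinearMap.comp_apply, hψ y hy, map_zero])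
  refine ⟨f, hf, fun a ha => ?_⟩
  have h2 : p ^ 2 • f a = 0 := by rw [← map_smul, hX a ha, map_zero]
  obtain ⟨w, hw⟩ := exists_eq_of_pow_smul hp hm h2
  refine ⟨w, hw, socleMap_injective hp (by omega : 1 ≤ m) ?_⟩
  have h1 := hf ⟨p ^ 1 • a, a, ha, rfl⟩
  rw [LinearMap.comp_apply] at h1
  rw [← h1, socleMap_mk]
  change f (p ^ 1 • a) = _
  rw [map_smul, hw, mk_smul_mk]
  congr 1
  rw [mul_left_comm, ← pow_add]
  congr 2
  omega

/-- The second coordinate of a morphism to a bipicket with a prescribed action on `p A`.  On `A` it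
has to be `x ↦ ψ (p x) p ^ (r - 1)`, which vanishes on `A ∩ p ^ r B`. -/
theorem exists_second_coordinate (hp : Prime p) (r : ℕ) {X : Emb R}
    (ψ : powMul p 1 X.A →ₗ[R] ResidueRing p)
    (hψ : ∀ y : powMul p 1 X.A, (y : X.B) ∈ powMul p 1 (X.A ⊓ powMul p r ⊤) → ψ y = 0) :
    ∃ f : X.B →ₗ[R] R ⧸ Ideal.span {p ^ r}, ∀ (a : X.B) (ha : a ∈ X.A),
      f a = socleMap p r (ψ ⟨p ^ 1 • a, a, ha, rfl⟩) := by
  let s : X.A →ₗ[R] powMul p 1 X.A :=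
    (LinearMap.lsmul R X.B (p ^ 1)).restrict fun a ha => ⟨a, ha, rfl⟩
  obtain ⟨f, hf, -⟩ := exists_extend hp (A := X.A) (C := powMul p r ⊤)
    (socleMap p r ∘ₗ ψ ∘ₗ s) (fun x => ⟨x, trivial, rfl⟩)
    (fun a ha => by
      rw [LinearMap.comp_apply, LinearMap.comp_apply, hψ (s a) ⟨a, ⟨a.2, ha⟩, rfl⟩, map_zero])
  exact ⟨f, fun a ha => hf ⟨a, ha⟩⟩

/-- Every admissible functional comes from a morphism to the corresponding embedding of a cyclic
module. -/
theorem exists_hom_cyclicPair (hp : Prime p) {m r : ℕ} (hm : 2 ≤ m) {X : Emb R}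
    (hX : ∀ a ∈ X.A, p ^ 2 • a = 0) {ψ : powMul p 1 X.A →ₗ[R] ResidueRing p}
    (hψ : Admissible p m r ψ) :
    ∃ g : Hom X (cyclicPair p m r),
      Realizes ((Ideal.Quotient.mk _ (p ^ (m - 1)), 0) : (cyclicPair p m r).B) g.1 ψ := by
  obtain ⟨f₁, hf₁, hf₁'⟩ := exists_first_coordinate hp hm hX ψ hψ.1
  obtain ⟨f₂, hf₂⟩ := exists_second_coordinate hp r ψ hψ.2
  have key : ∀ (a : X.B) (ha : a ∈ X.A), ∃ w : R, (f₁ a, f₂ a) =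
      w • ((Ideal.Quotient.mk _ (p ^ (m - 2)), Ideal.Quotient.mk _ (p ^ (r - 1))) :
        (cyclicPair p m r).B) := fun a ha => by
    obtain ⟨w, hw, hw'⟩ := hf₁' a ha
    exact ⟨w, Prod.ext hw (by rw [hf₂ a ha, hw']; rfl)⟩
  refine ⟨⟨f₁.prod f₂, fun a ha => ?_⟩, fun y w hw => Prod.ext ?_ ?_⟩
  · obtain ⟨w, hw⟩ := key a ha
    exact Submodule.mem_span_singleton.2 ⟨w, hw.symm⟩
  · change f₁ y = _
    rw [hf₁, hw]
    rfl
  · obtain ⟨_, a, ha, rfl⟩ := y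
    change f₂ (p ^ 1 • a) = w • (0 : R ⧸ Ideal.span {p ^ r})
    obtain ⟨v, hv⟩ := key a ha
    rw [map_smul, show f₂ a = _ from congrArg Prod.snd hv, smul_zero]
    change Ideal.Quotient.mk (Ideal.span {p ^ r}) (p ^ 1 * (v * p ^ (r - 1))) = 0
    rw [Ideal.Quotient.eq_zero_iff_mem, Ideal.mem_span_singleton, mul_left_comm, ← pow_add]
    exact (pow_dvd_pow p (by omega)).mul_left _

end Coordinates

end Emb

end Klein

/-! ### The common properties of pickets and bipickets -/

namespace Klein
namespace Emb

section Target

variable {R : Type u} [CommRing R] (p : R)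

/-- The submodule `p (A ∩ p ^ (r - 1) B) ∩ p ^ (m - 1) B` of `B`.  If `(A ⊂ B)` lies in
`S_2`, its elements are the images of the socle element `p a` of `T_2^{m,r}` under the morphisms
from `T_2^{m,r}`, where `a` generates the submodule of `T_2^{m,r}`. -/
def socleTrace (m r : ℕ) (X : Emb R) : Submodule R X.B :=
  powMul p 1 (X.A ⊓ powMul p (r - 1) ⊤) ⊓ powMul p (m - 1) ⊤

/-- There is a morphism `v : G → T` in `S_2` through which all admissible functionals of level
`(m, r)` are realized (as multiples of `t`), although the composition of `v` with any morphism
`T → G` annihilates `t`. -/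
def RadicalCover (T : Emb R) (t : T.B) (m r : ℕ) : Prop :=
  ∃ (G : Emb R) (v : Hom G T), G.InS2 p ∧ (∀ s : Hom T G, v.1 (s.1 t) = 0) ∧
    ∀ (X : Emb R) (ψ : powMul p 1 X.A →ₗ[R] ResidueRing p), X.InS2 p → Admissible p m r ψ →
      ∃ g : Hom X G, Realizes t (v.1 ∘ₗ g.1) ψ

/-- The properties of the object `T = T_2^{m,r}` with generator `a` of its submodule, on which
the sink map and the multiplicity formula depend.  They are common to pickets and bipickets. -/
structure IsModel (m r : ℕ) (T : Emb R) (a : T.B) : Prop where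
  inS2 : T.InS2 p
  span_eq : T.A = Submodule.span R {a}
  ne_zero : p • a ≠ 0
  mem_pow : a ∈ powMul p (r - 1) (⊤ : Submodule R T.B)
  smul_mem_pow : p • a ∈ powMul p (m - 1) (⊤ : Submodule R T.B)
  pow_smul : ∀ x : T.B, p ^ m • x = 0
  smul_eq_zero : ∀ x ∈ T.A, x ∈ powMul p r (⊤ : Submodule R T.B) → p • x = 0
  /-- Every admissible functional of level `(m, r)` comes from a morphism to `T`. -/
  exists_hom : ∀ (X : Emb R) (ψ : powMul p 1 X.A →ₗ[R] ResidueRing p), X.InS2 p →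
    Admissible p m r ψ → ∃ f : Hom X T, Realizes (p • a) f.1 ψ
  /-- Every element of `socleTrace p m r X` comes from a morphism from `T`. -/
  exists_hom_from : ∀ X : Emb R, X.InS2 p → ∀ x ∈ socleTrace p m r X,
    ∃ g : Hom T X, g.1 (p • a) = x
  isAutomorphism : ∀ h : Hom T T, h.1 (p • a) ≠ 0 → IsAutomorphism h
  cover_left : RadicalCover p T (p • a) m (r - 1)
  cover_right : RadicalCover p T (p • a) (m - 1) r

variable {p}

theorem RadicalCover.of_forall_eq_zero {T : Emb R} (hT : T.InS2 p) (t : T.B) {m r : ℕ}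
    (h : ∀ (X : Emb R) (ψ : powMul p 1 X.A →ₗ[R] ResidueRing p), Admissible p m r ψ → ψ = 0)
    (ht : p • t = 0) : RadicalCover p T t m r := by
  refine ⟨T, 0, hT, fun s => rfl, fun X ψ _ hψ => ⟨0, fun y w hw => ?_⟩⟩
  rw [h X ψ hψ] at hw
  obtain ⟨c, rfl⟩ := Ideal.mem_span_singleton.1 (Ideal.Quotient.eq_zero_iff_mem.1 hw.symm)
  rw [mul_comm, mul_smul, ht, smul_zero]
  rfl

variable (p) in
/-- The linear map `R / (p ^ n) → M` that sends `1` to a given element annihilated by `p ^ n`. -/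
def quotientHom {M : Type*} [AddCommGroup M] [Module R M] (n : ℕ) (b : M) (hb : p ^ n • b = 0) :
    (R ⧸ Ideal.span {p ^ n}) →ₗ[R] M :=
  Submodule.liftQ (Ideal.span {p ^ n}) (LinearMap.toSpanSingleton R M b) (by
    rw [Ideal.span_le, Set.singleton_subset_iff]
    exact hb)

theorem quotientHom_mk {M : Type*} [AddCommGroup M] [Module R M] (n : ℕ) (b : M)
    (hb : p ^ n • b = 0) (s : R) :
    quotientHom p n b hb (Ideal.Quotient.mk _ s) = s • b := rfl

/-- There are no nonzero admissible functionals of level `(m, r)` with `m ≤ 1` or `r = 0`. -/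
theorem admissible_eq_zero_of_le_one {m r : ℕ} (h : m ≤ 1 ∨ r = 0) (X : Emb R)
    (ψ : powMul p 1 X.A →ₗ[R] ResidueRing p) (hψ : Admissible p m r ψ) : ψ = 0 := by
  refine LinearMap.ext fun y => ?_
  rcases h with h | rfl
  · obtain ⟨_, a, ha, rfl⟩ := y
    refine hψ.1 _ ⟨p ^ (1 - m) • a, trivial, ?_⟩
    change p ^ m • p ^ (1 - m) • a = p ^ 1 • a
    rw [smul_smul, ← pow_add]
    congr 2
    omega
  · obtain ⟨_, a, ha, rfl⟩ := y
    exact hψ.2 _ ⟨a, ⟨ha, a, trivial, by simp⟩, rfl⟩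

theorem smul_mk_pow (i : ℕ) {m j : ℕ} (h : i + 1 = j) :
    p • Ideal.Quotient.mk (Ideal.span {p ^ m}) (p ^ i) = Ideal.Quotient.mk _ (p ^ j) := by
  rw [mk_smul_mk, ← pow_succ', h]

theorem mk_pow_mem_powMul {m i j : ℕ} (h : i ≤ j) :
    Ideal.Quotient.mk (Ideal.span {p ^ m}) (p ^ j) ∈
      powMul p i (⊤ : Submodule R (R ⧸ Ideal.span {p ^ m})) :=
  ⟨Ideal.Quotient.mk _ (p ^ (j - i)), trivial, by
    rw [LinearMap.lsmul_apply, mk_smul_mk, ← pow_add, Nat.add_sub_cancel' h]⟩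

end Target

section Models

variable {R : Type u} [CommRing R] [IsDomain R] {p : R}

theorem mk_mul_pow_pred_ne_zero (hp : Prime p) {m : ℕ} (hm : 1 ≤ m) :
    Ideal.Quotient.mk (Ideal.span {p ^ m}) (p ^ (m - 1)) ≠ 0 := by
  have h := (mk_mul_pow_pred_eq_zero_iff hp hm 1).not.2 hp.not_dvd_one
  rwa [one_mul] at h

theorem cyclicPair_smul_eq_zero (hp : Prime p) {m r : ℕ} (hr : 1 ≤ r) :
    ∀ x ∈ (cyclicPair p m r).A, x ∈ powMul p r (⊤ : Submodule R (cyclicPair p m r).B) →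
      p • x = 0 := by
  rintro x hx ⟨y, -, hy⟩
  obtain ⟨c, rfl⟩ := Submodule.mem_span_singleton.1 hx
  have h2 : Ideal.Quotient.mk (Ideal.span {p ^ r}) (c * p ^ (r - 1)) = 0 :=
    (congrArg Prod.snd hy).symm.trans (pow_smul_quotient le_rfl y.2)
  rw [mk_mul_pow_pred_eq_zero_iff hp hr] at h2
  obtain ⟨d, rfl⟩ := h2
  rw [Prod.smul_mk, Prod.smul_mk]
  refine Prod.ext ?_ ?_ <;>
  · simp only [mk_smul_mk]
    refine Ideal.Quotient.eq_zero_iff_mem.2 (Ideal.mem_span_singleton.2 ?_)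
    rw [show ∀ e, p * (p * d * e) = d * (p ^ 2 * e) from fun e => by ring, ← pow_add]
    exact (pow_dvd_pow p (by omega)).mul_left _

variable [IsPrincipalIdealRing R]

theorem inS2_picket (hp : Prime p) {m : ℕ} (hm : 2 ≤ m) : (picket p 2 m).InS2 p := by
  refine ⟨⟨isFiniteLength_quotient_pow hp m, m, fun x => pow_smul_quotient le_rfl x⟩, ?_⟩
  intro a ha
  obtain ⟨c, rfl⟩ := Submodule.mem_span_singleton.1 ha
  rw [mk_smul_mk, mk_smul_mk, Ideal.Quotient.eq_zero_iff_mem, Ideal.mem_span_singleton,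
    mul_left_comm, ← pow_add]
  exact (pow_dvd_pow p (by omega)).mul_left _

theorem inS2_cyclicPair (hp : Prime p) {m r : ℕ} (hm : 2 ≤ m) : (cyclicPair p m r).InS2 p := by
  refine ⟨⟨?_, m + r, fun x => Prod.ext (pow_smul_quotient (by omega) x.1)
    (pow_smul_quotient (by omega) x.2)⟩, ?_⟩
  · have h₁ := Module.length_ne_top_iff.2 (isFiniteLength_quotient_pow hp m)
    have h₂ := Module.length_ne_top_iff.2 (isFiniteLength_quotient_pow hp r)
    rw [← Module.length_ne_top_iff, Module.length_prod]
    exact WithTop.add_ne_top.2 ⟨h₁, h₂⟩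
  · intro a ha
    obtain ⟨c, rfl⟩ := Submodule.mem_span_singleton.1 ha
    rw [Prod.smul_mk, Prod.smul_mk]
    simp only [mk_smul_mk]
    refine Prod.ext ?_ ?_ <;>
    · refine Ideal.Quotient.eq_zero_iff_mem.2 (Ideal.mem_span_singleton.2 ?_)
      rw [mul_left_comm, ← pow_add]
      exact (pow_dvd_pow p (by omega)).mul_left _

/-- A morphism `cyclicPair p m r → T` that sends `(p ^ (m - 1), 0)` to `t` realizes the admissible
functionals of level `(m, r)`; it is a radical cover if every morphism back annihilates `t`. -/
theorem RadicalCover.of_cyclicPair (hp : Prime p) {m r : ℕ} (hm : 2 ≤ m) {T : Emb R} {t : T.B}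
    (u : Hom (cyclicPair p m r) T) (hu : u.1 (Ideal.Quotient.mk _ (p ^ (m - 1)), 0) = t)
    (hs : ∀ s : Hom T (cyclicPair p m r), s.1 t = 0) : RadicalCover p T t m r := by
  refine ⟨_, u, inS2_cyclicPair hp hm, fun s => by rw [hs, map_zero], fun X ψ hX hψ => ?_⟩
  obtain ⟨g, hg⟩ := exists_hom_cyclicPair hp hm hX.2 hψ
  exact ⟨g, fun y w hw => by rw [LinearMap.comp_apply, hg y w hw, map_smul, hu]⟩

theorem RadicalCover.of_cyclicPair_left (hp : Prime p) {m r : ℕ} (hr : 2 ≤ r) (hm : 2 ≤ m)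
    {T : Emb R} {a : T.B} (haA : a ∈ T.A)
    (har : a ∈ powMul p (r - 1) (⊤ : Submodule R T.B)) (u : Hom (cyclicPair p m (r - 1)) T)
    (hu : u.1 (Ideal.Quotient.mk _ (p ^ (m - 1)), 0) = p • a) :
    RadicalCover p T (p • a) m (r - 1) :=
  RadicalCover.of_cyclicPair hp hm u hu fun s => by
    rw [map_smul]
    exact cyclicPair_smul_eq_zero hp (by omega) _ (s.2 _ haA) (map_mem_powMul s.1 har)

theorem RadicalCover.of_cyclicPair_right (hp : Prime p) {m r : ℕ} (hm : 3 ≤ m) (hr : r + 1 ≤ m)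
    {T : Emb R} {t : T.B} (ht : t ∈ powMul p (m - 1) (⊤ : Submodule R T.B))
    (u : Hom (cyclicPair p (m - 1) r) T)
    (hu : u.1 (Ideal.Quotient.mk _ (p ^ (m - 1 - 1)), 0) = t) :
    RadicalCover p T t (m - 1) r :=
  RadicalCover.of_cyclicPair hp (by omega) u hu fun s => by
    obtain ⟨y, -, hy⟩ := map_mem_powMul s.1 ht
    rw [← hy]
    exact Prod.ext (pow_smul_quotient le_rfl y.1) (pow_smul_quotient (by omega) y.2)

theorem isModel_picket (hp : Prime p) {m r : ℕ} (hr : 1 ≤ r) (hm : r + 1 = m) :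
    IsModel p m r (picket p 2 m) (Ideal.Quotient.mk _ (p ^ (m - 2))) := by
  have hτ : p • Ideal.Quotient.mk (Ideal.span {p ^ m}) (p ^ (m - 2)) =
      Ideal.Quotient.mk _ (p ^ (m - 1)) := smul_mk_pow _ (by omega)
  have hmem : Ideal.Quotient.mk (Ideal.span {p ^ m}) (p ^ (m - 2)) ∈ (picket p 2 m).A :=
    Submodule.mem_span_singleton_self _
  have hpow : Ideal.Quotient.mk (Ideal.span {p ^ m}) (p ^ (m - 2)) ∈
      powMul p (r - 1) (⊤ : Submodule R (picket p 2 m).B) := mk_pow_mem_powMul (by omega)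
  have hpow' : p • Ideal.Quotient.mk (Ideal.span {p ^ m}) (p ^ (m - 2)) ∈
      powMul p (m - 1) (⊤ : Submodule R (picket p 2 m).B) := by
    rw [hτ]; exact mk_pow_mem_powMul le_rfl
  have hS2 := inS2_picket hp (m := m) (by omega)
  refine ⟨hS2, rfl, ?_, hpow, hpow', fun x => pow_smul_quotient le_rfl x, ?_, ?_, ?_, ?_, ?_, ?_⟩
  · rw [hτ]
    exact mk_mul_pow_pred_ne_zero hp (by omega)
  · rintro x - ⟨y, -, rfl⟩
    change p • p ^ r • y = 0
    rw [smul_smul, ← pow_succ']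
    exact pow_smul_quotient (by omega) y
  · intro X ψ hX hψ
    obtain ⟨f, hf, hf'⟩ := exists_first_coordinate hp (by omega : 2 ≤ m) hX.2 ψ hψ.1
    refine ⟨⟨f, fun a ha => ?_⟩, fun y w hw => ?_⟩
    · obtain ⟨w, hw, -⟩ := hf' a ha
      exact Submodule.mem_span_singleton.2 ⟨w, hw.symm⟩
    · rw [hτ, mk_smul_mk]
      change f y = _
      rw [hf, hw, socleMap_mk]
  · rintro X hX x ⟨⟨x, ⟨hxA, b, -, rfl⟩, rfl⟩, -⟩
    have hb : p ^ m • b = 0 := by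
      rw [← hX.2 _ hxA, LinearMap.lsmul_apply, smul_smul, ← pow_add]
      congr 2
      omega
    have hg : ∀ s, quotientHom p m b hb (Ideal.Quotient.mk _ s) = s • b := quotientHom_mk m b hb
    refine ⟨⟨quotientHom p m b hb, fun a ha => ?_⟩, ?_⟩
    · obtain ⟨c, rfl⟩ := Submodule.mem_span_singleton.1 ha
      rw [map_smul, hg]
      refine X.A.smul_mem c ?_
      rw [show m - 2 = r - 1 by omega]
      exact hxA
    · rw [hτ, hg, LinearMap.lsmul_apply, LinearMap.lsmul_apply, smul_smul, ← pow_add]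
      congr 2
      omega
  · intro h hh
    refine isAutomorphism_of_injective hS2.1.1 h
      (injective_of_socle (n := m) (fun x => pow_smul_quotient le_rfl x) h.1 fun z hz hhz => ?_)
    obtain ⟨α, rfl⟩ := exists_eq_of_pow_smul hp (by omega : 1 ≤ m) (by rwa [pow_one])
    obtain ⟨c, hc⟩ := Ideal.Quotient.mk_surjective (h.1 (Ideal.Quotient.mk _ 1))
    have hx : ∀ x : R, h.1 (Ideal.Quotient.mk _ x) = Ideal.Quotient.mk _ (x * c) := fun x => by
      rw [← mk_smul_mk, hc, ← map_smul, mk_smul_mk, mul_one]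
    rw [hτ, hx, mul_comm, ne_eq, mk_mul_pow_pred_eq_zero_iff hp (by omega)] at hh
    rw [hx, mul_right_comm, mk_mul_pow_pred_eq_zero_iff hp (by omega)] at hhz
    exact (mk_mul_pow_pred_eq_zero_iff hp (by omega) _).2 ((hp.dvd_or_dvd hhz).resolve_right hh)
  · rcases hr.eq_or_lt with rfl | hr'
    · exact RadicalCover.of_forall_eq_zero hS2 _ (admissible_eq_zero_of_le_one (Or.inr rfl))
        (by rw [smul_smul, ← pow_two]; exact hS2.2 _ hmem)
    · refine RadicalCover.of_cyclicPair_left hp hr' (by omega) hmem hpow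
        ⟨LinearMap.fst R _ _, fun a ha => ?_⟩ hτ.symm
      obtain ⟨c, rfl⟩ := Submodule.mem_span_singleton.1 ha
      exact (picket p 2 m).A.smul_mem c hmem
  · rcases (show 2 ≤ m by omega).eq_or_lt with rfl | hm'
    · exact RadicalCover.of_forall_eq_zero hS2 _ (admissible_eq_zero_of_le_one (Or.inl le_rfl))
        (by rw [smul_smul, ← pow_two]; exact hS2.2 _ hmem)
    · have hb : p ^ (m - 1) • Ideal.Quotient.mk (Ideal.span {p ^ m}) p = 0 := by
        rw [mk_smul_mk, ← pow_succ, Ideal.Quotient.eq_zero_iff_mem, Ideal.mem_span_singleton]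
        exact pow_dvd_pow p (by omega)
      refine RadicalCover.of_cyclicPair_right hp hm' (by omega) hpow'
        ⟨quotientHom p (m - 1) _ hb ∘ₗ LinearMap.fst R _ _, fun a ha => ?_⟩ ?_
      · obtain ⟨c, rfl⟩ := Submodule.mem_span_singleton.1 ha
        rw [map_smul, LinearMap.comp_apply, LinearMap.fst_apply, quotientHom_mk, mk_smul_mk,
          ← pow_succ, show m - 1 - 2 + 1 = m - 2 by omega]
        exact (picket p 2 m).A.smul_mem c hmem
      · change quotientHom p (m - 1) _ hb (Ideal.Quotient.mk _ _) = _
        rw [quotientHom_mk, hτ, mk_smul_mk, ← pow_succ, show m - 1 - 1 + 1 = m - 1 by omega]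

theorem isModel_cyclicPair (hp : Prime p) {m r : ℕ} (hr : 1 ≤ r) (hm : r + 2 ≤ m) :
    IsModel p m r (cyclicPair p m r)
      (Ideal.Quotient.mk _ (p ^ (m - 2)), Ideal.Quotient.mk _ (p ^ (r - 1))) := by
  set a : (cyclicPair p m r).B :=
    (Ideal.Quotient.mk _ (p ^ (m - 2)), Ideal.Quotient.mk _ (p ^ (r - 1)))
  have hS2 := inS2_cyclicPair hp (m := m) (r := r) (by omega)
  have hmem : a ∈ (cyclicPair p m r).A := Submodule.mem_span_singleton_self _
  have hτ : p • a = (Ideal.Quotient.mk _ (p ^ (m - 1)), 0) := by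
    refine Prod.ext (smul_mk_pow _ (by omega)) ((smul_mk_pow _ rfl).trans ?_)
    rw [Ideal.Quotient.eq_zero_iff_mem, Ideal.mem_span_singleton]
    exact pow_dvd_pow p (by omega)
  have hpow : a ∈ powMul p (r - 1) (⊤ : Submodule R (cyclicPair p m r).B) := by
    obtain ⟨x, -, hx⟩ := mk_pow_mem_powMul (p := p) (m := m) (show r - 1 ≤ m - 2 by omega)
    obtain ⟨y, -, hy⟩ := mk_pow_mem_powMul (p := p) (m := r) (le_refl (r - 1))
    exact ⟨(x, y), trivial, Prod.ext hx hy⟩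
  have hpow' : p • a ∈ powMul p (m - 1) (⊤ : Submodule R (cyclicPair p m r).B) := by
    rw [hτ]
    obtain ⟨x, -, hx⟩ := mk_pow_mem_powMul (p := p) (m := m) (le_refl (m - 1))
    exact ⟨(x, 0), trivial, Prod.ext hx (smul_zero _)⟩
  refine ⟨hS2, rfl, ?_, hpow, hpow', fun x => Prod.ext (pow_smul_quotient le_rfl x.1)
    (pow_smul_quotient (by omega) x.2), cyclicPair_smul_eq_zero hp hr, ?_, ?_, ?_, ?_, ?_⟩
  · rw [hτ]
    exact fun h => mk_mul_pow_pred_ne_zero hp (by omega) (congrArg Prod.fst h)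
  · intro X ψ hX hψ
    rw [hτ]
    exact exists_hom_cyclicPair hp (by omega) hX.2 hψ
  · rintro X hX x ⟨⟨x, ⟨hxA, b', -, rfl⟩, rfl⟩, b, -, hb⟩
    simp only [LinearMap.lsmul_apply, pow_one] at hxA hb ⊢
    rw [smul_smul, ← pow_succ', Nat.sub_add_cancel hr] at hb
    have hb0 : p ^ m • b = 0 := by
      rw [← hX.2 _ hxA, show m = 1 + (m - 1) by omega, pow_add, mul_smul, hb, smul_smul, smul_smul,
        ← pow_add, ← pow_add]
      congr 2
      omega
    -- The morphism sends the generators to `b` and `c`, where `c` is chosen such that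
    -- `p ^ (m - 2) b + p ^ (r - 1) c` is the given element `p ^ (r - 1) b'` of `X.A`.
    obtain ⟨c, hc⟩ : ∃ c, c = b' - p ^ (m - 1 - r) • b := ⟨_, rfl⟩
    have hc1 : p ^ (m - 2) • b + p ^ (r - 1) • c = p ^ (r - 1) • b' := by
      rw [hc, smul_sub, smul_smul, ← pow_add, show r - 1 + (m - 1 - r) = m - 2 by omega]
      abel
    have hc0 : p ^ r • c = 0 := by
      rw [hc, smul_sub, smul_smul, ← pow_add, show r + (m - 1 - r) = m - 1 by omega, hb, sub_self]
    let g : (cyclicPair p m r).B →ₗ[R] X.B :=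
      (quotientHom p m b hb0).coprod (quotientHom p r c hc0)
    have hg : g a = p ^ (r - 1) • b' := by
      rw [← hc1]; rfl
    refine ⟨⟨g, fun y hy => ?_⟩, ?_⟩
    · obtain ⟨d, rfl⟩ := Submodule.mem_span_singleton.1 hy
      rw [map_smul, hg]
      exact X.A.smul_mem d hxA
    · change g (p • a) = _
      rw [map_smul, hg]
  · intro h hh
    refine isAutomorphism_of_injective hS2.1.1 h (injective_of_socle (n := m)
      (fun x => Prod.ext (pow_smul_quotient le_rfl x.1) (pow_smul_quotient (by omega) x.2)) h.1
      fun z hz hhz => ?_)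
    obtain ⟨w, hw⟩ := Submodule.mem_span_singleton.1 (h.2 a hmem)
    have hw0 : ¬ p ∣ w := by
      rintro ⟨d, rfl⟩
      refine hh ?_
      have h2 : p • (p * d) • a = d • p ^ 2 • a := by rw [smul_smul, smul_smul]; congr 1; ring
      rw [map_smul, ← hw, h2, hS2.2 a hmem, smul_zero]
    obtain ⟨α, hα⟩ := exists_eq_of_pow_smul hp (by omega : 1 ≤ m) (x := z.1)
      (by rw [pow_one]; exact congrArg Prod.fst hz)
    obtain ⟨β, hβ⟩ := exists_eq_of_pow_smul hp hr (x := z.2)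
      (by rw [pow_one]; exact congrArg Prod.snd hz)
    -- The socle is generated by `p • a` and by `a - p ^ (m - 2) • (1, 0) = (0, p ^ (r - 1))`.
    have hz' : z = α • p • a + β • (a - p ^ (m - 2) •
        ((Ideal.Quotient.mk _ 1, 0) : (cyclicPair p m r).B)) := by
      rw [hτ]
      refine Prod.ext (hα.trans ?_) (hβ.trans ?_)
      · change _ = α • Ideal.Quotient.mk (Ideal.span {p ^ m}) (p ^ (m - 1)) +
          β • (Ideal.Quotient.mk (Ideal.span {p ^ m}) (p ^ (m - 2)) -
            p ^ (m - 2) • Ideal.Quotient.mk (Ideal.span {p ^ m}) 1)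
        rw [mk_smul_mk, mk_smul_mk, mul_one, sub_self, smul_zero, add_zero]
      · change _ = α • (0 : R ⧸ Ideal.span {p ^ r}) +
          β • (Ideal.Quotient.mk (Ideal.span {p ^ r}) (p ^ (r - 1)) -
            p ^ (m - 2) • (0 : R ⧸ Ideal.span {p ^ r}))
        rw [smul_zero, smul_zero, sub_zero, zero_add, mk_smul_mk]
    rw [hz', map_add, map_smul, map_smul, map_smul, map_sub, map_smul, ← hw] at hhz
    have hβ0 : p ∣ β := by
      have h2 := congrArg Prod.snd hhz
      simp only [Prod.snd_add, Prod.smul_snd, Prod.snd_sub, Prod.snd_zero] at h2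
      rw [pow_smul_quotient (by omega : r ≤ m - 2), sub_zero, smul_comm p w,
        show p • a.2 = 0 from congrArg Prod.snd hτ, smul_zero, smul_zero, zero_add, smul_smul] at h2
      exact ((hp.dvd_or_dvd ((mk_mul_pow_pred_eq_zero_iff hp hr _).1 h2)).resolve_right hw0)
    have hz2 : z.2 = 0 := by
      rw [hβ]
      exact (mk_mul_pow_pred_eq_zero_iff hp hr _).2 hβ0
    have hzα : z = α • p • a := by
      rw [hτ]
      exact Prod.ext hα (hz2.trans (smul_zero _).symm)
    have hα0 : p ∣ α := by
      have h3 : h.1 z = 0 := by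
        rw [hz', map_add, map_smul, map_smul, map_smul, map_sub, map_smul, ← hw]
        exact hhz
      rw [hzα, map_smul, map_smul, ← hw, smul_comm p w, hτ, smul_smul] at h3
      exact ((hp.dvd_or_dvd ((mk_mul_pow_pred_eq_zero_iff hp (by omega) _).1
        (congrArg Prod.fst h3))).resolve_right hw0)
    refine Prod.ext (hα.trans ?_) hz2
    exact (mk_mul_pow_pred_eq_zero_iff hp (by omega) _).2 hα0
  · rcases hr.eq_or_lt with rfl | hr'
    · exact RadicalCover.of_forall_eq_zero hS2 _ (admissible_eq_zero_of_le_one (Or.inr rfl))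
        (by rw [smul_smul, ← pow_two]; exact hS2.2 _ hmem)
    · have hb : p ^ (r - 1) • Ideal.Quotient.mk (Ideal.span {p ^ r}) p = 0 := by
        rw [mk_smul_mk, ← pow_succ, Ideal.Quotient.eq_zero_iff_mem, Ideal.mem_span_singleton]
        exact pow_dvd_pow p (by omega)
      refine RadicalCover.of_cyclicPair_left hp hr' (by omega) hmem hpow
        ⟨LinearMap.id.prodMap (quotientHom p (r - 1) _ hb), fun y hy => ?_⟩ ?_
      · obtain ⟨c, rfl⟩ := Submodule.mem_span_singleton.1 hy
        rw [map_smul]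
        refine (cyclicPair p m r).A.smul_mem c ?_
        convert hmem
        refine Prod.ext rfl ?_
        change quotientHom p (r - 1) _ hb (Ideal.Quotient.mk _ _) = _
        rw [quotientHom_mk, mk_smul_mk, ← pow_succ, show r - 1 - 1 + 1 = r - 1 by omega]
      · rw [hτ]
        exact Prod.ext rfl (map_zero (quotientHom p (r - 1) _ hb))
  · have hb : p ^ (m - 1) • Ideal.Quotient.mk (Ideal.span {p ^ m}) p = 0 := by
      rw [mk_smul_mk, ← pow_succ, Ideal.Quotient.eq_zero_iff_mem, Ideal.mem_span_singleton]
      exact pow_dvd_pow p (by omega)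
    refine RadicalCover.of_cyclicPair_right hp (by omega) (by omega) hpow'
      ⟨(quotientHom p (m - 1) _ hb).prodMap LinearMap.id, fun y hy => ?_⟩ ?_
    · obtain ⟨c, rfl⟩ := Submodule.mem_span_singleton.1 hy
      rw [map_smul]
      refine (cyclicPair p m r).A.smul_mem c ?_
      convert hmem
      refine Prod.ext ?_ rfl
      change quotientHom p (m - 1) _ hb (Ideal.Quotient.mk _ _) = _
      rw [quotientHom_mk, mk_smul_mk, ← pow_succ, show m - 1 - 2 + 1 = m - 2 by omega]
    · rw [hτ]
      refine Prod.ext ?_ rfl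
      change quotientHom p (m - 1) _ hb (Ideal.Quotient.mk _ _) = _
      rw [quotientHom_mk, mk_smul_mk, ← pow_succ, show m - 1 - 1 + 1 = m - 1 by omega]

theorem exists_isModel_bipicket (hp : Prime p) {m r : ℕ} (hr : 1 ≤ r) (hm : r + 1 ≤ m) :
    ∃ a, IsModel p m r (bipicket p m r) a := by
  by_cases h : r + 1 = m
  · rw [show bipicket p m r = picket p 2 m from if_pos h]
    exact ⟨_, isModel_picket hp hr h⟩
  · rw [show bipicket p m r = cyclicPair p m r from if_neg h]
    exact ⟨_, isModel_cyclicPair hp hr (by omega)⟩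

end Models

end Emb
end Klein

/-! ### The sink map -/

namespace Klein
namespace Emb

section Prod

variable {R : Type u} [CommRing R] {p : R}

/-- The direct sum of two embeddings. -/
abbrev prod (E F : Emb R) : Emb R where
  B := E.B × F.B
  A := E.A.prod F.A

theorem InS2.prod {E F : Emb R} (hE : E.InS2 p) (hF : F.InS2 p) : (E.prod F).InS2 p := by
  obtain ⟨⟨hE₁, i, hi⟩, hE₂⟩ := hE
  obtain ⟨⟨hF₁, j, hj⟩, hF₂⟩ := hF
  refine ⟨⟨?_, i + j, fun x => Prod.ext ?_ ?_⟩, fun x hx => Prod.ext (hE₂ _ hx.1) (hF₂ _ hx.2)⟩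
  · rw [← Module.length_ne_top_iff] at hE₁ hF₁ ⊢
    rw [Module.length_prod]
    exact WithTop.add_ne_top.2 ⟨hE₁, hF₁⟩
  · change p ^ (i + j) • x.1 = 0
    rw [add_comm, pow_add, mul_smul, hi, smul_zero]
  · change p ^ (i + j) • x.2 = 0
    rw [pow_add, mul_smul, hj, smul_zero]

theorem isSplitEpimorphism_iff {X Z : Emb R} {f : Hom X Z} :
    IsSplitEpimorphism f ↔ ∃ s : Hom Z X, ∀ z, f.1 (s.1 z) = z := by
  refine exists_congr fun s => ⟨fun h z => ?_, fun h => Subtype.ext (LinearMap.ext h)⟩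
  exact LinearMap.congr_fun (congrArg Subtype.val h) z

theorem map_mem_socleTrace {X Y : Emb R} (f : Hom X Y) {m r : ℕ} {x : X.B}
    (hx : x ∈ socleTrace p m r X) : f.1 x ∈ socleTrace p m r Y := by
  obtain ⟨⟨x, ⟨hxA, hxr⟩, rfl⟩, hxm⟩ := hx
  refine ⟨⟨f.1 x, ⟨f.2 x hxA, map_mem_powMul f.1 hxr⟩, ?_⟩, map_mem_powMul f.1 hxm⟩
  exact (map_smul f.1 _ x).symm

end Prod

namespace IsModel

variable {R : Type u} [CommRing R] [IsDomain R] [IsPrincipalIdealRing R] {p : R}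
  {m r : ℕ} {T : Emb R} {a : T.B}

section

omit [IsDomain R] [IsPrincipalIdealRing R]

theorem mem (h : IsModel p m r T a) : a ∈ T.A :=
  h.span_eq ▸ Submodule.mem_span_singleton_self a

theorem smul_smul_eq_zero (h : IsModel p m r T a) : p • p • a = 0 := by
  rw [smul_smul, ← pow_two]
  exact h.inS2.2 a h.mem

theorem smul_mem_socleTrace (h : IsModel p m r T a) : p • a ∈ socleTrace p m r T :=
  ⟨⟨a, ⟨h.mem, h.mem_pow⟩, by rw [LinearMap.lsmul_apply, pow_one]⟩, h.smul_mem_pow⟩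

theorem exists_map_smul_eq (h : IsModel p m r T a) {X : Emb R} (f : Hom X T) {x : X.B}
    (hx : x ∈ X.A) : ∃ w : R, f.1 x = w • a := by
  have h1 := f.2 x hx
  rw [h.span_eq] at h1
  obtain ⟨w, hw⟩ := Submodule.mem_span_singleton.1 h1
  exact ⟨w, hw.symm⟩

theorem exists_map_eq (h : IsModel p m r T a) {X : Emb R} (f : Hom X T) {y : X.B}
    (hy : y ∈ powMul p 1 X.A) : ∃ w : R, f.1 y = w • p • a := by
  obtain ⟨x, hx, rfl⟩ := hy
  obtain ⟨w, hw⟩ := h.exists_map_smul_eq f hx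
  exact ⟨w, by rw [LinearMap.lsmul_apply, pow_one, map_smul, hw, smul_comm]⟩

/-- A morphism `X → T` in `S_2` is a split epimorphism if and only if it does not vanish on
`socleTrace p m r X`. -/
theorem isSplitEpimorphism_iff (h : IsModel p m r T a) {X : Emb R} (hX : X.InS2 p)
    (f : Hom X T) : IsSplitEpimorphism f ↔ ∃ x ∈ socleTrace p m r X, f.1 x ≠ 0 := by
  rw [Emb.isSplitEpimorphism_iff]
  constructor
  · rintro ⟨s, hs⟩
    exact ⟨_, map_mem_socleTrace s h.smul_mem_socleTrace, by rw [hs]; exact h.ne_zero⟩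
  · rintro ⟨x, hx, hfx⟩
    obtain ⟨g, rfl⟩ := h.exists_hom_from X hX x hx
    obtain ⟨k, hk, -⟩ := h.isAutomorphism (homMap T f g) hfx
    exact ⟨homMap T g k, fun z => LinearMap.congr_fun (congrArg Subtype.val hk) z⟩

end

theorem smul_eq_zero_iff (hp : Prime p) (h : IsModel p m r T a) (w : R) :
    w • p • a = 0 ↔ p ∣ w := by
  refine ⟨fun hw => ?_, ?_⟩
  · by_contra hpw
    obtain ⟨x, y, hxy⟩ := (hp.irreducible.coprime_iff_not_dvd.2 hpw)
    refine h.ne_zero ?_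
    rw [← one_smul R (p • a), ← hxy, add_smul, mul_smul, mul_smul, hw, h.smul_smul_eq_zero,
      smul_zero, smul_zero, add_zero]
  · rintro ⟨d, rfl⟩
    rw [mul_comm, mul_smul, h.smul_smul_eq_zero, smul_zero]

/-- The coefficient of a multiple of the socle element `p • a`. -/
theorem exists_socleEquiv (hp : Prime p) (h : IsModel p m r T a) :
    ∃ e : Submodule.span R {p • a} ≃ₗ[R] ResidueRing p,
      ∀ x (w : R), e x = Ideal.Quotient.mk _ w ↔ (x : T.B) = w • p • a := by
  have ht : Ideal.span {p} = Ideal.torsionOf R T.B (p • a) := by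
    ext w
    rw [Ideal.mem_span_singleton, Ideal.mem_torsionOf_iff, h.smul_eq_zero_iff hp]
  refine ⟨((Submodule.quotEquivOfEq _ _ ht).trans
    (Ideal.quotTorsionOfEquivSpanSingleton R T.B (p • a))).symm, fun x w => ?_⟩
  rw [LinearEquiv.symm_apply_eq]
  exact Subtype.ext_iff

/-- The functional on `p A` induced by a morphism from `(A ⊂ B)` to `T`. -/
theorem exists_functional (hp : Prime p) (h : IsModel p m r T a) {X : Emb R} (f : Hom X T) :
    ∃ ψ : powMul p 1 X.A →ₗ[R] ResidueRing p,
      ∀ y w, ψ y = Ideal.Quotient.mk _ w ↔ f.1 y = w • p • a := by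
  obtain ⟨e, he⟩ := h.exists_socleEquiv hp
  have hf : ∀ y ∈ powMul p 1 X.A, f.1 y ∈ Submodule.span R {p • a} := fun y hy => by
    obtain ⟨w, hw⟩ := h.exists_map_eq f hy
    exact Submodule.mem_span_singleton.2 ⟨w, hw.symm⟩
  exact ⟨e.toLinearMap ∘ₗ f.1.restrict hf, fun y w => he _ w⟩

/-- A functional induced by a morphism that is not a split epimorphism is the sum of a functional
of level `(m, r - 1)` and one of level `(m - 1, r)`. -/
theorem exists_admissible_add (hp : Prime p) (h : IsModel p m r T a) {X : Emb R} (f : Hom X T)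
    (hf : ∀ x ∈ socleTrace p m r X, f.1 x = 0) {ψ : powMul p 1 X.A →ₗ[R] ResidueRing p}
    (hX : ∀ x ∈ X.A, p ^ 2 • x = 0)
    (hψ : ∀ y w, ψ y = Ideal.Quotient.mk _ w ↔ f.1 y = w • p • a) :
    ∃ ψ₁ ψ₂, ψ = ψ₁ + ψ₂ ∧ Admissible p m (r - 1) ψ₁ ∧ Admissible p (m - 1) r ψ₂ := by
  have hψ0 : ∀ y : powMul p 1 X.A, f.1 y = 0 → ψ y = 0 := fun y hy =>
    ((hψ y 0).2 (by rw [hy, zero_smul])).trans (map_zero _)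
  have hm : ∀ y : powMul p 1 X.A, (y : X.B) ∈ powMul p m (⊤ : Submodule R X.B) → ψ y = 0 := by
    rintro y ⟨b, -, hb⟩
    refine hψ0 y ?_
    rw [← hb, LinearMap.lsmul_apply, map_smul, h.pow_smul]
  have hr : ∀ y : powMul p 1 X.A, (y : X.B) ∈ powMul p 1 (X.A ⊓ powMul p r ⊤) → ψ y = 0 := by
    rintro y ⟨x, hx, hxy⟩
    refine hψ0 y ?_
    rw [← hxy, LinearMap.lsmul_apply, map_smul, pow_one]
    exact h.smul_eq_zero _ (f.2 x hx.1) (map_mem_powMul f.1 hx.2)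
  have hle : powMul p 1 (X.A ⊓ powMul p (r - 1) ⊤) ≤ powMul p 1 X.A :=
    Submodule.map_mono inf_le_left
  obtain ⟨ψ₁, ψ₂, hadd, h₁, h₂⟩ := exists_add_of_inf hp (M := powMul p 1 X.A)
    (by
      rintro ⟨_, x, hx, rfl⟩
      refine Subtype.ext ?_
      change p • p ^ 1 • x = 0
      rw [smul_smul, ← pow_succ']
      exact hX x hx)
    ((powMul p 1 (X.A ⊓ powMul p (r - 1) ⊤) ⊔ powMul p m ⊤).comap (powMul p 1 X.A).subtype)
    ((powMul p (m - 1) ⊤).comap (powMul p 1 X.A).subtype) ψ (by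
      intro y hy₁ hy₂
      obtain ⟨y₁, hy₁, y₂, hy₂', hy⟩ := Submodule.mem_sup.1 hy₁
      have e : y = ⟨y₁, hle hy₁⟩ + (y - ⟨y₁, hle hy₁⟩) := by abel
      have e₂ : ((y - ⟨y₁, hle hy₁⟩ : powMul p 1 X.A) : X.B) = y₂ := by
        rw [Submodule.coe_sub, ← (show y₁ + y₂ = (y : X.B) from hy)]
        simp
      rw [e, map_add, hm (y - ⟨y₁, hle hy₁⟩) (by rw [e₂]; exact hy₂'), add_zero]
      refine hψ0 _ (hf _ ⟨hy₁, ?_⟩)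
      have e₁ : y₁ = (y : X.B) - y₂ := by rw [← (show y₁ + y₂ = (y : X.B) from hy)]; simp
      change y₁ ∈ _
      rw [e₁]
      exact Submodule.sub_mem _ hy₂ (powMul_top_antitone (Nat.sub_le m 1) hy₂'))
  refine ⟨ψ₁, ψ₂, hadd, ⟨fun y hy => h₁ y (Submodule.mem_sup_right hy),
    fun y hy => h₁ y (Submodule.mem_sup_left hy)⟩, fun y hy => h₂ y hy, fun y hy => ?_⟩
  have e : ψ₂ = ψ - ψ₁ := by rw [hadd]; abel
  have hy' : (y : X.B) ∈ powMul p 1 (X.A ⊓ powMul p (r - 1) ⊤) :=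
    Submodule.map_mono (inf_le_inf_left _ (powMul_top_antitone (Nat.sub_le r 1))) hy
  rw [e, LinearMap.sub_apply, hr y hy, h₁ y (Submodule.mem_sup_left hy'), sub_zero]

/-- A right almost split map with target `T`.  Its source is the direct sum of the sources of the
two covers and of `(p A ⊂ B)`, where `T = (A ⊂ B)`. -/
theorem exists_rightAlmostSplit (hp : Prime p) (h : IsModel p m r T a) :
    ∃ (Y : Emb R) (v : Hom Y T), Y.InS2 p ∧ ¬ IsSplitEpimorphism v ∧
      ∀ X : Emb R, X.InS2 p → ∀ f : Hom X T, ¬ IsSplitEpimorphism f →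
        ∃ g : Hom X Y, homMap X v g = f := by
  obtain ⟨G₁, v₁, hG₁, hv₁, hc₁⟩ := h.cover_left
  obtain ⟨G₂, v₂, hG₂, hv₂, hc₂⟩ := h.cover_right
  have hle : powMul p 1 T.A ≤ T.A := by
    rintro _ ⟨x, hx, rfl⟩
    exact T.A.smul_mem _ hx
  let N : Emb R := { B := T.B, A := powMul p 1 T.A }
  have hN : N.InS2 p := ⟨h.inS2.1, fun x hx => h.inS2.2 x (hle hx)⟩
  let v : ((G₁.prod G₂).prod N).B →ₗ[R] T.B := (v₁.1.coprod v₂.1).coprod LinearMap.id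
  have hv : ∀ x, v x = v₁.1 x.1.1 + v₂.1 x.1.2 + x.2 := fun x => rfl
  refine ⟨(G₁.prod G₂).prod N, ⟨v, fun x hx => ?_⟩, (hG₁.prod hG₂).prod hN, ?_, ?_⟩
  · rw [hv]
    exact add_mem (add_mem (v₁.2 _ hx.1.1) (v₂.2 _ hx.1.2)) (hle hx.2)
  · rw [Emb.isSplitEpimorphism_iff]
    rintro ⟨s, hs⟩
    have hs₁ := hv₁ ⟨LinearMap.fst R _ _ ∘ₗ LinearMap.fst R _ _ ∘ₗ s.1, fun x hx => (s.2 x hx).1.1⟩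
    have hs₂ := hv₂ ⟨LinearMap.snd R _ _ ∘ₗ LinearMap.fst R _ _ ∘ₗ s.1, fun x hx => (s.2 x hx).1.2⟩
    have hs₃ : (s.1 (p • a)).2 = 0 := by
      obtain ⟨x, hx, hxa⟩ := (s.2 a h.mem).2
      rw [map_smul]
      change p • (s.1 a).2 = 0
      rw [← hxa, LinearMap.lsmul_apply, smul_smul, ← pow_succ']
      exact h.inS2.2 x hx
    refine h.ne_zero ((hs (p • a)).symm.trans ?_)
    change v (s.1 (p • a)) = 0
    rw [hv, hs₃, add_zero]
    change v₁.1 (s.1 (p • a)).1.1 = 0 at hs₁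
    change v₂.1 (s.1 (p • a)).1.2 = 0 at hs₂
    rw [hs₁, hs₂, add_zero]
  · intro X hX f hf
    have hf0 : ∀ x ∈ socleTrace p m r X, f.1 x = 0 := fun x hx => by
      by_contra hne
      exact hf ((h.isSplitEpimorphism_iff hX f).2 ⟨x, hx, hne⟩)
    obtain ⟨ψ, hψ⟩ := h.exists_functional hp f
    obtain ⟨ψ₁, ψ₂, hadd, h₁, h₂⟩ := h.exists_admissible_add hp f hf0 hX.2 hψ
    obtain ⟨g₁, hg₁⟩ := hc₁ X ψ₁ hX h₁
    obtain ⟨g₂, hg₂⟩ := hc₂ X ψ₂ hX h₂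
    let k : X.B →ₗ[R] T.B := f.1 - (v₁.1 ∘ₗ g₁.1 + v₂.1 ∘ₗ g₂.1)
    have hkT : ∀ x ∈ X.A, k x ∈ T.A := fun x hx =>
      sub_mem (f.2 x hx) (add_mem (v₁.2 _ (g₁.2 x hx)) (v₂.2 _ (g₂.2 x hx)))
    have hk0 : ∀ y : powMul p 1 X.A, k y = 0 := fun y => by
      obtain ⟨w₁, hw₁⟩ := Ideal.Quotient.mk_surjective (ψ₁ y)
      obtain ⟨w₂, hw₂⟩ := Ideal.Quotient.mk_surjective (ψ₂ y)
      have hfy : f.1 y = (w₁ + w₂) • p • a :=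
        (hψ y _).1 (by rw [hadd, LinearMap.add_apply, ← hw₁, ← hw₂, map_add])
      have e₁ := hg₁ y w₁ hw₁.symm
      have e₂ := hg₂ y w₂ hw₂.symm
      change f.1 y - ((v₁.1 ∘ₗ g₁.1) y + (v₂.1 ∘ₗ g₂.1) y) = 0
      rw [hfy, e₁, e₂, add_smul, sub_self]
    -- As `k` annihilates `p X.A`, it sends `X.A` into the multiples of `p • a`.
    have hk : ∀ x ∈ X.A, k x ∈ powMul p 1 T.A := fun x hx => by
      obtain ⟨w, hw⟩ := h.exists_map_smul_eq ⟨k, hkT⟩ hx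
      have h0 : w • p • a = 0 := by
        have h1 := hk0 ⟨p ^ 1 • x, x, hx, rfl⟩
        change k (p ^ 1 • x) = 0 at h1
        rwa [map_smul, pow_one, show k x = w • a from hw, smul_comm] at h1
      obtain ⟨d, rfl⟩ := (h.smul_eq_zero_iff hp w).1 h0
      refine ⟨d • a, T.A.smul_mem d h.mem, ?_⟩
      rw [LinearMap.lsmul_apply, pow_one, smul_smul]
      exact hw.symm
    refine ⟨⟨(g₁.1.prod g₂.1).prod k, fun x hx => ⟨⟨g₁.2 x hx, g₂.2 x hx⟩, hk x hx⟩⟩,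
      Subtype.ext (LinearMap.ext fun x => ?_)⟩
    change v ((g₁.1 x, g₂.1 x), k x) = f.1 x
    rw [hv]
    exact add_sub_cancel _ _

/-- Among the right almost split maps with target `T`, one with a source of minimal length is a
sink map: an endomorphism `g` of the source with `v g = v` is surjective, because the restriction
of `v` to the image of `g` is again right almost split. -/
theorem exists_isSinkMap (hp : Prime p) (h : IsModel p m r T a) :
    ∃ (Y : Emb R) (v : Hom Y T), IsSinkMap p v := by
  let P : ℕ∞ → Prop := fun l => ∃ (Y : Emb R) (v : Hom Y T), Module.length R Y.B = l ∧
    Y.InS2 p ∧ ¬ IsSplitEpimorphism v ∧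
      ∀ X : Emb R, X.InS2 p → ∀ f : Hom X T, ¬ IsSplitEpimorphism f →
        ∃ g : Hom X Y, homMap X v g = f
  have hP : ∃ l, P l := by
    obtain ⟨Y, v, hY⟩ := h.exists_rightAlmostSplit hp
    exact ⟨_, Y, v, rfl, hY⟩
  obtain ⟨l, ⟨Y, v, hl, hY, hsplit, hfac⟩, hmin⟩ := WellFounded.has_min
    (wellFounded_lt (α := ℕ∞)) {l | P l} hP
  refine ⟨Y, v, hY, h.inS2, hsplit, hfac, fun g hg => ?_⟩
  have hvg : ∀ y, v.1 (g.1 y) = v.1 y := fun y =>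
    LinearMap.congr_fun (congrArg Subtype.val hg) y
  refine isAutomorphism_of_surjective hY.1.1 g ?_
  by_contra hsurj
  let Y' : Emb R := { B := LinearMap.range g.1, A := Y.A.comap (LinearMap.range g.1).subtype }
  let i : Hom Y' Y := ⟨(LinearMap.range g.1).subtype, fun x hx => hx⟩
  let q : Hom Y Y' := ⟨g.1.rangeRestrict, fun x hx => g.2 x hx⟩
  have hY' : Y'.InS2 p := by
    obtain ⟨⟨h₁, n, hn⟩, h₂⟩ := hY
    exact ⟨⟨h₁.of_injective (LinearMap.range g.1).injective_subtype, n,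
      fun x => Subtype.ext (hn x)⟩, fun x hx => Subtype.ext (h₂ x hx)⟩
  refine hmin (Module.length R Y'.B) ⟨Y', homMap Y' v i, rfl, hY', fun hs => hsplit ?_, ?_⟩ ?_
  · obtain ⟨s, hs⟩ := Emb.isSplitEpimorphism_iff.1 hs
    exact Emb.isSplitEpimorphism_iff.2 ⟨homMap T i s, hs⟩
  · intro X hX f hf
    obtain ⟨k, rfl⟩ := hfac X hX f hf
    exact ⟨homMap X q k, Subtype.ext (LinearMap.ext fun x => hvg (k.1 x))⟩
  · rw [← hl]
    obtain ⟨_, _⟩ := isFiniteLength_iff_isNoetherian_isArtinian.1 hY.1.1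
    exact Submodule.length_lt fun htop => hsurj (LinearMap.range_eq_top.1 htop)

end IsModel

end Emb
end Klein

/-! ### Decompositions into indecomposables -/

namespace Klein
namespace Emb

section Biproduct

variable {R : Type u} [CommRing R]

theorem iso_iff {E F : Emb R} :
    Iso E F ↔ ∃ (f : Hom E F) (g : Hom F E), (∀ x, g.1 (f.1 x) = x) ∧ ∀ y, f.1 (g.1 y) = y := by
  constructor
  · rintro ⟨e, he⟩
    refine ⟨⟨e.toLinearMap, fun x hx => he ▸ Submodule.mem_map_of_mem hx⟩,
      ⟨e.symm.toLinearMap, fun y hy => ?_⟩, e.symm_apply_apply, e.apply_symm_apply⟩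
    rw [← he] at hy
    obtain ⟨x, hx, rfl⟩ := hy
    exact (e.symm_apply_apply x).symm ▸ hx
  · rintro ⟨f, g, hgf, hfg⟩
    refine ⟨LinearEquiv.ofLinearMap f.1 g.1 (LinearMap.ext hfg) (LinearMap.ext hgf), ?_⟩
    refine le_antisymm ?_ fun y hy => ⟨g.1 y, g.2 y hy, hfg y⟩
    rintro _ ⟨x, hx, rfl⟩
    exact f.2 x hx

/-- The embedding `E` is a biproduct of the finite family `X`, in terms of inclusions and
projections. -/
def IsBiproduct (E : Emb R) {κ : Type} [Fintype κ] (X : κ → Emb R) : Prop :=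
  ∃ (i : ∀ k, Hom (X k) E) (q : ∀ k, Hom E (X k)), (∀ k x, (q k).1 ((i k).1 x) = x) ∧
    (∀ k l, k ≠ l → ∀ x, (q k).1 ((i l).1 x) = 0) ∧ ∀ y, ∑ k, (i k).1 ((q k).1 y) = y

theorem iso_directSum_iff {E : Emb R} {n : ℕ} {X : Fin n → Emb R} :
    Iso E (directSum X) ↔ IsBiproduct E X := by
  rw [iso_iff]
  constructor
  · rintro ⟨f, g, hgf, hfg⟩
    refine ⟨fun k => ⟨g.1 ∘ₗ LinearMap.single R (fun j => (X j).B) k,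
        fun x hx => g.2 _ fun j _ => ?_⟩,
      fun k => ⟨LinearMap.proj k ∘ₗ f.1, fun x hx => f.2 x hx k trivial⟩, fun k x => ?_,
      fun k l hkl x => ?_, fun y => ?_⟩
    · by_cases hj : j = k
      · subst hj
        simpa using hx
      · simp [Pi.single_eq_of_ne hj]
    · simp [hfg]
    · simp [hfg, Pi.single_eq_of_ne hkl]
    · have h1 : ∑ k, Pi.single k (f.1 y k) = f.1 y := Finset.univ_sum_single (f.1 y)
      have h2 := congrArg g.1 h1
      rw [map_sum, hgf] at h2
      exact h2
  · rintro ⟨i, q, h₁, h₂, h₃⟩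
    refine ⟨⟨LinearMap.pi fun k => (q k).1, fun x hx k _ => (q k).2 x hx⟩,
      ⟨∑ k, (i k).1 ∘ₗ LinearMap.proj k, fun x hx => ?_⟩, fun y => ?_, fun x => ?_⟩
    · rw [LinearMap.sum_apply]
      exact Submodule.sum_mem _ fun k _ => (i k).2 _ (hx k trivial)
    · rw [LinearMap.sum_apply]
      exact h₃ y
    · funext k
      rw [LinearMap.sum_apply]
      change (q k).1 (∑ l, (i l).1 (x l)) = x k
      rw [map_sum, Finset.sum_eq_single k (fun l _ hl => h₂ k l hl.symm _)
        (fun h => absurd (Finset.mem_univ k) h), h₁]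

theorem IsBiproduct.sigma {E : Emb R} {κ : Type} [Fintype κ] {X : κ → Emb R}
    (hE : IsBiproduct E X) {μ : κ → Type} [∀ k, Fintype (μ k)] {Y : ∀ k, μ k → Emb R}
    (hX : ∀ k, IsBiproduct (X k) (Y k)) :
    IsBiproduct E fun s : Σ k, μ k => Y s.1 s.2 := by
  obtain ⟨i, q, h₁, h₂, h₃⟩ := hE
  choose j w k₁ k₂ k₃ using hX
  refine ⟨fun s => homMap _ (i s.1) (j s.1 s.2), fun s => homMap _ (w s.1 s.2) (q s.1),
    fun s x => ?_, ?_, fun y => ?_⟩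
  · change (w s.1 s.2).1 ((q s.1).1 ((i s.1).1 ((j s.1 s.2).1 x))) = x
    rw [h₁, k₁]
  · rintro ⟨k, a⟩ ⟨l, b⟩ hne x
    change (w k a).1 ((q k).1 ((i l).1 ((j l b).1 x))) = 0
    by_cases hkl : k = l
    · subst hkl
      rw [h₁]
      exact k₂ k a b (fun hab => hne (by rw [hab])) x
    · rw [h₂ k l hkl, map_zero]
  · rw [Fintype.sum_sigma]
    change ∑ k, ∑ a, (i k).1 ((j k a).1 ((w k a).1 ((q k).1 y))) = y
    simp_rw [← map_sum, k₃]
    exact h₃ y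

theorem IsBiproduct.reindex {E : Emb R} {κ μ : Type} [Fintype κ] [Fintype μ] {X : κ → Emb R}
    (hE : IsBiproduct E X) (σ : μ ≃ κ) : IsBiproduct E fun k => X (σ k) := by
  obtain ⟨i, q, h₁, h₂, h₃⟩ := hE
  refine ⟨fun k => i (σ k), fun k => q (σ k), fun k => h₁ (σ k),
    fun k l hkl => h₂ _ _ (σ.injective.ne hkl), fun y => ?_⟩
  exact (σ.sum_comp fun k => (i k).1 ((q k).1 y)).trans (h₃ y)

/-- An indecomposable embedding with a nonzero retract `T` is isomorphic to `T`. -/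
theorem Indecomposable.iso_of_retract {X T : Emb R} (hX : Indecomposable X) [Nontrivial T.B]
    (f : Hom X T) (g : Hom T X) (hfg : ∀ t, f.1 (g.1 t) = t) : Iso X T := by
  let K : Emb R := { B := LinearMap.ker f.1, A := X.A.comap (LinearMap.ker f.1).subtype }
  have hK : ∀ x, x - g.1 (f.1 x) ∈ LinearMap.ker f.1 := fun x => by
    rw [LinearMap.mem_ker, map_sub, hfg, sub_self]
  let e : Hom K X := ⟨(LinearMap.ker f.1).subtype, fun x hx => hx⟩
  let c : Hom X K := ⟨(LinearMap.id - g.1 ∘ₗ f.1).codRestrict _ hK, fun x hx =>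
    X.A.sub_mem hx (g.2 _ (f.2 x hx))⟩
  have hiso : Iso X (directSum ![T, K]) := by
    rw [iso_directSum_iff]
    have hce : ∀ x : K.B, c.1 (e.1 x) = x := fun x => Subtype.ext (by
      change (x : X.B) - g.1 (f.1 x) = x
      rw [show f.1 x = 0 from x.2, map_zero, sub_zero])
    have hfe : ∀ x : K.B, f.1 (e.1 x) = 0 := fun x => x.2
    have hcg : ∀ t : T.B, c.1 (g.1 t) = 0 := fun t => Subtype.ext (by
      change g.1 t - g.1 (f.1 (g.1 t)) = 0
      rw [hfg, sub_self])
    refine ⟨Fin.cons g (Fin.cons e finZeroElim), Fin.cons f (Fin.cons c finZeroElim),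
      Fin.forall_fin_two.2 ⟨hfg, hce⟩, Fin.forall_fin_two.2
        ⟨Fin.forall_fin_two.2 ⟨fun h => absurd rfl h, fun _ => hfe⟩,
          Fin.forall_fin_two.2 ⟨fun _ => hcg, fun h => absurd rfl h⟩⟩, ?_⟩
    · intro y
      rw [Fin.sum_univ_two]
      change g.1 (f.1 y) + (y - g.1 (f.1 y)) = y
      abel
  rcases hX.2 _ hiso with h | h
  · exact absurd h (not_subsingleton T.B)
  · refine iso_iff.2 ⟨f, g, fun x => ?_, hfg⟩
    have h0 : (⟨_, hK x⟩ : LinearMap.ker f.1) = 0 := @Subsingleton.elim K.B h _ _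
    exact (sub_eq_zero.1 (congrArg Subtype.val h0)).symm

theorem exists_isDecomposition_of_length (l : ℕ) : ∀ E : Emb R, Module.length R E.B = l →
    ∃ (n : ℕ) (X : Fin n → Emb R), IsDecomposition E X := by
  induction l using Nat.strong_induction_on with
  | _ l ih =>
  intro E hl
  rcases subsingleton_or_nontrivial E.B with hE | hE
  · exact ⟨0, finZeroElim, finZeroElim, iso_directSum_iff.2 ⟨finZeroElim, finZeroElim,
      finZeroElim, finZeroElim, fun y => Subsingleton.elim _ _⟩⟩
  by_cases hind : Indecomposable E
  · refine ⟨1, fun _ => E, fun _ => hind, iso_directSum_iff.2 ⟨fun _ => idHom E, fun _ => idHom E,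
      fun _ _ => rfl, fun k l hkl => absurd (Subsingleton.elim k l) hkl, fun y => ?_⟩⟩
    rw [Fin.sum_univ_one]
    rfl
  · obtain ⟨X, hX, h0, h1⟩ : ∃ X : Fin 2 → Emb R, Iso E (directSum X) ∧
        Nontrivial (X 0).B ∧ Nontrivial (X 1).B := by
      by_contra hcon
      refine hind ⟨hE, fun X hX => ?_⟩
      by_contra hns
      rw [not_or, not_subsingleton_iff_nontrivial, not_subsingleton_iff_nontrivial] at hns
      exact hcon ⟨X, hX, hns⟩
    have hsum : Module.length R (X 0).B + Module.length R (X 1).B = l := by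
      obtain ⟨e, -⟩ := hX
      rw [← hl, e.length_eq, Module.length_pi_of_fintype, Fin.sum_univ_two]
    have hpos : ∀ k, 0 < Module.length R (X k).B :=
      Fin.forall_fin_two.2 ⟨Module.length_pos, Module.length_pos⟩
    have hlt : ∀ k, ∃ a : ℕ, a < l ∧ Module.length R (X k).B = a := by
      have hp₀ := hpos 0
      have hp₁ := hpos 1
      obtain ⟨a, ha⟩ := ENat.ne_top_iff_exists.1
        (show Module.length R (X 0).B ≠ ⊤ from fun h => by simp [h] at hsum)
      obtain ⟨b, hb⟩ := ENat.ne_top_iff_exists.1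
        (show Module.length R (X 1).B ≠ ⊤ from fun h => by simp [h] at hsum)
      rw [← ha, ← hb] at hsum
      rw [← ha] at hp₀
      rw [← hb] at hp₁
      norm_cast at hsum hp₀ hp₁
      exact Fin.forall_fin_two.2 ⟨⟨a, by omega, ha.symm⟩, ⟨b, by omega, hb.symm⟩⟩
    have hdec : ∀ k, ∃ (n : ℕ) (Y : Fin n → Emb R), IsDecomposition (X k) Y := fun k => by
      obtain ⟨a, hal, ha⟩ := hlt k
      exact ih a hal _ ha
    choose n Y hY using hdec
    let σ := (Fintype.equivFin (Σ k, Fin (n k))).symm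
    refine ⟨_, fun s => Y (σ s).1 (σ s).2, fun s => (hY _).1 _, iso_directSum_iff.2 ?_⟩
    exact ((iso_directSum_iff.1 hX).sigma fun k => iso_directSum_iff.1 (hY k).2).reindex σ

theorem exists_isDecomposition {E : Emb R} (hE : IsFiniteLength R E.B) :
    ∃ (n : ℕ) (X : Fin n → Emb R), IsDecomposition E X := by
  obtain ⟨l, hl⟩ := ENat.ne_top_iff_exists.1 (Module.length_ne_top_iff.2 hE)
  exact exists_isDecomposition_of_length l E hl.symm

end Biproduct

end Emb
end Klein

/-! ### The dimension of the morphisms modulo the radical -/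

namespace Klein

section Length

variable {R : Type u} [CommRing R] {p : R} {M : Type*} [AddCommGroup M] [Module R M]

theorem length_eq_of_ker_eq {N P : Type*} [AddCommGroup N] [Module R N] [AddCommGroup P]
    [Module R P] {f : M →ₗ[R] N} {g : M →ₗ[R] P} (hf : Function.Surjective f)
    (hg : Function.Surjective g) (h : ∀ x, f x = 0 ↔ g x = 0) :
    Module.length R N = Module.length R P :=
  LinearEquiv.length_eq <| (f.quotKerEquivOfSurjective hf).symm.trans <|
    (Submodule.quotEquivOfEq _ _ (Submodule.ext h)).trans (g.quotKerEquivOfSurjective hg)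

theorem length_map_mkQ (Z : Submodule R M) {W W' : Submodule R M} (hW : W ≤ W') :
    Module.length R (Z.map W.mkQ) =
      Module.length R ((Z ⊓ W').map W.mkQ) + Module.length R (Z.map W'.mkQ) := by
  have hg : ∀ x ∈ Z.map W.mkQ, Submodule.factor hW x ∈ Z.map W'.mkQ := by
    rintro _ ⟨z, hz, rfl⟩
    exact ⟨z, hz, rfl⟩
  refine Module.length_eq_add_of_exact
    (Submodule.inclusion (Submodule.map_mono inf_le_left)) ((Submodule.factor hW).restrict hg)
    (Submodule.inclusion_injective _) ?_ ?_
  · rintro ⟨_, z, hz, rfl⟩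
    exact ⟨⟨W.mkQ z, z, hz, rfl⟩, rfl⟩
  · rintro ⟨_, z, hz, rfl⟩
    constructor
    · intro h0
      have hz' : z ∈ W' := (Submodule.Quotient.mk_eq_zero W').1 (congrArg Subtype.val h0)
      exact ⟨⟨W.mkQ z, z, ⟨hz, hz'⟩, rfl⟩, rfl⟩
    · rintro ⟨⟨_, z', hz', rfl⟩, h'⟩
      refine Subtype.ext ?_
      change Submodule.factor hW (W.mkQ z) = 0
      rw [← show W.mkQ z' = W.mkQ z from congrArg Subtype.val h']
      exact (Submodule.Quotient.mk_eq_zero W').2 hz'.2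

/-- The number of boxes in row `m` of a difference of diagrams.  The subtraction is truncated. -/
theorem ncard_row_diff {N P : Type u} [AddCommGroup N] [Module R N] [AddCommGroup P] [Module R P]
    {m : ℕ} (hm : 1 ≤ m) :
    {b ∈ typeDiagram p N \ typeDiagram p P | b.1 = m}.ncard =
      conjType p N m - conjType p P m := by
  have h : {b ∈ typeDiagram p N \ typeDiagram p P | b.1 = m} =
      (fun j => (m, j)) '' (Finset.Ioc (conjType p P m) (conjType p N m) : Set ℕ) := by
    ext ⟨i, j⟩
    simp only [typeDiagram, Set.mem_sdiff, Set.mem_ofPred_eq, Set.mem_image, Finset.coe_Ioc,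
      Set.mem_Ioc, Prod.mk.injEq]
    constructor
    · rintro ⟨⟨⟨h₁, h₂, h₃⟩, h₄⟩, rfl⟩
      exact ⟨j, ⟨by by_contra hj; exact h₄ ⟨h₁, h₂, by omega⟩, h₃⟩, rfl, rfl⟩
    · rintro ⟨j, ⟨h₁, h₂⟩, rfl, rfl⟩
      exact ⟨⟨⟨hm, by omega, h₂⟩, fun h => by omega⟩, rfl⟩
  rw [h, Set.ncard_image_of_injective _ fun i j hij => (Prod.mk.inj hij).2, Set.ncard_coe_finset,
    Nat.card_Ioc]

/-- The parts of the conjugate type of a quotient `M / U` are the lengths of the images of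
`p ^ (m - 1) M` in `M / (U + p ^ m M)`. -/
theorem conjType_eq_length [IsDomain R] [IsPrincipalIdealRing R] (hp : Prime p) {M N : Type u}
    [AddCommGroup M] [Module R M] [AddCommGroup N] [Module R N] (hM : IsFiniteLength R M)
    {q : M →ₗ[R] N}
    (hq : Function.Surjective q) {m : ℕ} (hm : 1 ≤ m) :
    (conjType p N m : ℕ∞) = Module.length R
      ((powMul p (m - 1) (⊤ : Submodule R M)).map (LinearMap.ker q ⊔ powMul p m ⊤).mkQ) := by
  have hN : IsFiniteLength R N := hM.of_surjective hq
  have hmap : ∀ x ∈ powMul p (m - 1) (⊤ : Submodule R M),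
      q x ∈ powMul p (m - 1) (⊤ : Submodule R N) := by
    rintro _ ⟨y, -, rfl⟩
    exact ⟨q y, trivial, (map_smul q _ y).symm⟩
  have hmem : ∀ x : powMul p (m - 1) (⊤ : Submodule R N),
      x ∈ Ideal.span {p} • (⊤ : Submodule R (powMul p (m - 1) (⊤ : Submodule R N))) ↔
        ∃ y : N, p ^ m • y = x := fun x => by
    rw [Submodule.ideal_span_singleton_smul]
    constructor
    · rintro ⟨⟨_, y, -, rfl⟩, -, rfl⟩
      refine ⟨y, ?_⟩
      change p ^ m • y = p • p ^ (m - 1) • y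
      rw [smul_smul, ← pow_succ', Nat.sub_add_cancel hm]
    · rintro ⟨y, hy⟩
      refine ⟨⟨p ^ (m - 1) • y, y, trivial, rfl⟩, trivial, Subtype.ext ?_⟩
      change p • p ^ (m - 1) • y = x
      rw [smul_smul, ← pow_succ', Nat.sub_add_cancel hm, hy]
  rw [conjType, finrank_eq_length hp
    ((hN.of_injective (Submodule.injective_subtype _)).of_surjective
      (Submodule.mkQ_surjective _))]
  refine length_eq_of_ker_eq (M := powMul p (m - 1) (⊤ : Submodule R M))
    (f := Submodule.mkQ _ ∘ₗ q.restrict hmap)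
    (g := ((LinearMap.ker q ⊔ powMul p m ⊤).mkQ).submoduleMap _)
    ((Submodule.mkQ_surjective _).comp ?_) (LinearMap.submoduleMap_surjective _ _) fun x => ?_
  · rintro ⟨_, y, -, rfl⟩
    obtain ⟨y, rfl⟩ := hq y
    exact ⟨⟨p ^ (m - 1) • y, y, trivial, rfl⟩, Subtype.ext (map_smul q _ y)⟩
  · rw [LinearMap.comp_apply, Submodule.mkQ_apply, Submodule.Quotient.mk_eq_zero, hmem,
      ← Submodule.coe_eq_zero]
    change _ ↔ Submodule.Quotient.mk (x : M) = 0
    rw [Submodule.Quotient.mk_eq_zero]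
    constructor
    · rintro ⟨y, hy⟩
      obtain ⟨y, rfl⟩ := hq y
      refine Submodule.mem_sup.2 ⟨x - p ^ m • y, ?_, p ^ m • y, ⟨y, trivial, rfl⟩, by abel⟩
      rw [LinearMap.mem_ker, map_sub, map_smul, hy]
      exact sub_self _
    · intro h
      obtain ⟨u, hu, _, ⟨y, -, rfl⟩, hx⟩ := Submodule.mem_sup.1 h
      refine ⟨q y, ?_⟩
      change _ = q x
      rw [← hx, map_add, LinearMap.mem_ker.1 hu, zero_add, LinearMap.lsmul_apply, map_smul]

end Length

namespace Emb

section Radical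

variable {R : Type u} [CommRing R]

variable (p : R) in
/-- The morphisms `X → T` that vanish on `socleTrace p m r X`.  If `T` is a model of `T_2^{m,r}`
and `X` lies in `S_2`, they are the morphisms that are not split epimorphisms. -/
def radical (m r : ℕ) (X T : Emb R) : Submodule R (Hom X T) where
  carrier := {f | ∀ x ∈ socleTrace p m r X, f.1 x = 0}
  add_mem' {f g} hf hg x hx := by
    change f.1 x + g.1 x = 0
    rw [hf x hx, hg x hx, add_zero]
  zero_mem' _ _ := rfl
  smul_mem' c f hf x hx := by
    change c • f.1 x = 0
    rw [hf x hx, smul_zero]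

theorem mem_radical {p : R} {m r : ℕ} {X T : Emb R} {f : Hom X T} :
    f ∈ radical p m r X T ↔ ∀ x ∈ socleTrace p m r X, f.1 x = 0 := Iff.rfl

/-- The image in `B / (p (A ∩ p ^ r B) + p ^ m B)` of `socleTrace p m r (A ⊂ B)`. -/
abbrev socleQuotient (p : R) (m r : ℕ) (X : Emb R) :
    Submodule R (X.B ⧸ (powMul p 1 (X.A ⊓ powMul p r ⊤) ⊔ powMul p m ⊤)) :=
  (socleTrace p m r X).map (Submodule.mkQ _)

end Radical

namespace IsModel

variable {R : Type u} [CommRing R] [IsDomain R] [IsPrincipalIdealRing R] {p : R}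
  {m r : ℕ} {T : Emb R} {a : T.B}

omit [IsDomain R] [IsPrincipalIdealRing R] in
/-- For a sink map `v`, the image of `Hom(X, v)` is the radical; in particular it does not depend
on `v`. -/
theorem range_homMap (h : IsModel p m r T a) {X Y : Emb R} (hX : X.InS2 p) {v : Hom Y T}
    (hv : IsSinkMap p v) : LinearMap.range (homMap X v) = radical p m r X T := by
  ext f
  have hsplit : f ∈ radical p m r X T ↔ ¬ IsSplitEpimorphism f := by
    rw [h.isSplitEpimorphism_iff hX, mem_radical]
    push Not
    rfl
  rw [hsplit]
  refine ⟨?_, fun hf => hv.factors X hX f hf⟩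
  rintro ⟨g, rfl⟩ hs
  obtain ⟨s, hs⟩ := Emb.isSplitEpimorphism_iff.1 hs
  exact hv.not_split (Emb.isSplitEpimorphism_iff.2 ⟨homMap T g s, hs⟩)

/-- Evaluation at suitable elements `l i` of `socleTrace p m r X` identifies the morphisms `X → T`
modulo the radical with a coordinate space over `R / (p)`. -/
theorem nonempty_quotient_radical_equiv (hp : Prime p) (h : IsModel p m r T a) {X : Emb R}
    {ι : Type} [Finite ι] (l : ι → X.B) (hl : ∀ i, l i ∈ socleTrace p m r X)
    (hsep : ∀ f : Hom X T, (∀ i, f.1 (l i) = 0) → f ∈ radical p m r X T)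
    (hsurj : ∀ c : ι → R, ∃ f : Hom X T, ∀ i, f.1 (l i) = c i • p • a) :
    Nonempty ((Hom X T ⧸ radical p m r X T) ≃ₗ[R] (ι → ResidueRing p)) := by
  obtain ⟨e, he⟩ := h.exists_socleEquiv hp
  have hmem : ∀ i, l i ∈ powMul p 1 X.A := fun i =>
    Submodule.map_mono (inf_le_left : X.A ⊓ powMul p (r - 1) ⊤ ≤ X.A) (hl i).1
  have hspan : ∀ (i : ι) (f : Hom X T),
      (LinearMap.applyₗ (l i) ∘ₗ (Hom X T).subtype) f ∈ Submodule.span R {p • a} := fun i f => by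
    obtain ⟨w, hw⟩ := h.exists_map_eq f (hmem i)
    exact Submodule.mem_span_singleton.2 ⟨w, hw.symm⟩
  let θ : Hom X T →ₗ[R] (ι → ResidueRing p) := LinearMap.pi fun i =>
    e.toLinearMap ∘ₗ (LinearMap.applyₗ (l i) ∘ₗ (Hom X T).subtype).codRestrict _ (hspan i)
  have hθ : ∀ f i w, θ f i = Ideal.Quotient.mk _ w ↔ f.1 (l i) = w • p • a := fun f i w =>
    he _ w
  have hker : LinearMap.ker θ = radical p m r X T := by
    ext f
    rw [LinearMap.mem_ker]
    constructor
    · intro hf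
      refine hsep f fun i => ?_
      rw [(hθ f i 0).1 ((congrFun hf i).trans (map_zero _).symm), zero_smul]
    · intro hf
      funext i
      rw [(hθ f i 0).2 (by rw [hf _ (hl i), zero_smul]), map_zero, Pi.zero_apply]
  have hθs : Function.Surjective θ := fun c => by
    choose c' hc' using fun i => Ideal.Quotient.mk_surjective (c i)
    obtain ⟨f, hf⟩ := hsurj c'
    exact ⟨f, funext fun i => ((hθ f i _).2 (hf i)).trans (hc' i)⟩
  exact ⟨(Submodule.quotEquivOfEq _ _ hker.symm).trans (θ.quotKerEquivOfSurjective hθs)⟩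

/-- The dimension of the space of morphisms `X → T` modulo the radical, computed from
`socleQuotient`: the two spaces are dual to each other. -/
theorem nonempty_equiv_of_length_socleQuotient (hp : Prime p) (h : IsModel p m r T a) {X : Emb R}
    (hX : X.InS2 p) {N : ℕ} (hN : Module.length R (socleQuotient p m r X) = N) :
    Nonempty ((Hom X T ⧸ radical p m r X T) ≃ₗ[R] (Fin N → ResidueRing p)) := by
  have hpA : ∀ y ∈ powMul p 1 X.A, p • y = 0 := by
    rintro _ ⟨x, hx, rfl⟩
    rw [LinearMap.lsmul_apply, smul_smul, ← pow_succ']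
    exact hX.2 x hx
  have htr : socleTrace p m r X ≤ powMul p 1 X.A :=
    inf_le_left.trans (Submodule.map_mono inf_le_left)
  set W := powMul p 1 (X.A ⊓ powMul p r ⊤) ⊔ powMul p m (⊤ : Submodule R X.B)
  obtain ⟨e⟩ := nonempty_equiv_of_length hp (M := socleQuotient p m r X)
    (by
      rintro ⟨_, y, hy, rfl⟩
      refine Subtype.ext ?_
      change p • W.mkQ y = 0
      rw [← map_smul, hpA y (htr hy), map_zero]) hN
  have hlift : ∀ i, ∃ x ∈ socleTrace p m r X, W.mkQ x = e.symm (Pi.single i 1) :=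
    fun i => (e.symm (Pi.single i 1)).2
  choose l hl hle using hlift
  have hfW : ∀ (f : Hom X T), ∀ x ∈ W, f.1 x = 0 := fun f => by
    change W ≤ LinearMap.ker f.1
    refine sup_le ?_ ?_
    · rintro _ ⟨x, hx, rfl⟩
      rw [LinearMap.mem_ker, LinearMap.lsmul_apply, map_smul, pow_one]
      exact h.smul_eq_zero _ (f.2 x hx.1) (map_mem_powMul f.1 hx.2)
    · rintro _ ⟨x, -, rfl⟩
      rw [LinearMap.mem_ker, LinearMap.lsmul_apply, map_smul, h.pow_smul]
  refine h.nonempty_quotient_radical_equiv hp l hl (fun f hf x hx => ?_) fun c => ?_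
  · let f' : (Fin N → ResidueRing p) →ₗ[R] T.B :=
      W.liftQ f.1 (hfW f) ∘ₗ (socleQuotient p m r X).subtype ∘ₗ e.symm.toLinearMap
    have hf' : f' = 0 := by
      refine LinearMap.pi_ext' fun i => LinearMap.ext fun w => ?_
      obtain ⟨w, rfl⟩ := Ideal.Quotient.mk_surjective w
      have hw : LinearMap.single R (fun _ => ResidueRing p) i (Ideal.Quotient.mk _ w) =
          w • Pi.single i 1 := by
        rw [← map_one (Ideal.Quotient.mk (Ideal.span {p})), ← LinearMap.single_apply R,
          ← map_smul]
        congr 1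
        exact congrArg _ (mul_one w).symm
      rw [LinearMap.comp_apply, hw, map_smul]
      change w • W.liftQ f.1 (hfW f) (e.symm (Pi.single i 1) : socleQuotient p m r X) = 0
      rw [← hle i]
      change w • f.1 (l i) = 0
      rw [hf i, smul_zero]
    have h1 := LinearMap.congr_fun hf' (e ⟨W.mkQ x, x, hx, rfl⟩)
    change W.liftQ f.1 (hfW f) (e.symm (e ⟨W.mkQ x, x, hx, rfl⟩) : socleQuotient p m r X) = 0 at h1
    rw [e.symm_apply_apply] at h1
    exact h1
  · let lam : socleQuotient p m r X →ₗ[R] ResidueRing p :=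
      (∑ i, c i • LinearMap.proj i) ∘ₗ e.toLinearMap
    let A₀ : Submodule R (powMul p 1 X.A) := (socleTrace p m r X).comap (powMul p 1 X.A).subtype
    obtain ⟨ψ, hψ, hψW⟩ := exists_extend_residue hp (A := A₀)
      (C := W.comap (powMul p 1 X.A).subtype)
      (lam ∘ₗ (W.mkQ ∘ₗ (powMul p 1 X.A).subtype).restrict fun y hy => ⟨y, hy, rfl⟩)
      (fun y => by
        rw [show p • y = 0 from Subtype.ext (hpA y y.2)]
        exact Submodule.zero_mem _)
      (fun y hy => by
        rw [LinearMap.comp_apply]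
        convert map_zero lam
        exact Subtype.ext ((Submodule.Quotient.mk_eq_zero W).2 hy))
    obtain ⟨f, hf⟩ := h.exists_hom X ψ hX
      ⟨fun y hy => hψW y (Submodule.mem_sup_right hy),
        fun y hy => hψW y (Submodule.mem_sup_left hy)⟩
    refine ⟨f, fun i => hf ⟨l i, htr (hl i)⟩ (c i) ?_⟩
    rw [hψ ⟨⟨l i, htr (hl i)⟩, hl i⟩]
    have h1 : (⟨W.mkQ (l i), l i, hl i, rfl⟩ : socleQuotient p m r X) = e.symm (Pi.single i 1) :=
      Subtype.ext (hle i)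
    change lam ⟨W.mkQ (l i), l i, hl i, rfl⟩ = _
    rw [h1, LinearMap.comp_apply, LinearEquiv.coe_coe, e.apply_symm_apply, LinearMap.sum_apply,
      Finset.sum_eq_single i]
    · rw [LinearMap.smul_apply, LinearMap.proj_apply, Pi.single_eq_same]
      exact congrArg (Ideal.Quotient.mk _) (mul_one (c i))
    · intro j _ hj
      rw [LinearMap.smul_apply, LinearMap.proj_apply, Pi.single_eq_of_ne hj, smul_zero]
    · exact fun hi => absurd (Finset.mem_univ i) hi

/-- The dimension of the space of morphisms `X → T` modulo the radical, computed from a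
decomposition of `X`: only the summands isomorphic to `T` contribute. -/
theorem nonempty_equiv_of_isDecomposition (hp : Prime p) (h : IsModel p m r T a) {F : Emb R}
    (hF : F.InS2 p) {n : ℕ} {X : Fin n → Emb R} (hX : IsDecomposition F X) :
    Nonempty ((Hom F T ⧸ radical p m r F T) ≃ₗ[R] ({i // Iso (X i) T} → ResidueRing p)) := by
  classical
  obtain ⟨hind, hiso⟩ := hX
  obtain ⟨i, q, h₁, h₂, h₃⟩ := iso_directSum_iff.1 hiso
  have hT : Nontrivial T.B := ⟨⟨_, _, h.ne_zero⟩⟩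
  have hαβ : ∀ k : {k // Iso (X k) T}, ∃ (f : Hom (X k) T) (g : Hom T (X k)),
      (∀ x, g.1 (f.1 x) = x) ∧ ∀ y, f.1 (g.1 y) = y := fun k => iso_iff.1 k.2
  choose α β hβα hαβ using hαβ
  refine h.nonempty_quotient_radical_equiv hp (fun k => (i k).1 ((β k).1 (p • a)))
    (fun k => map_mem_socleTrace (i k) (map_mem_socleTrace (β k) h.smul_mem_socleTrace))
    (fun f hf x hx => ?_) fun c => ?_
  · -- Insert the identity of `F` between `g` and `f`.  Endomorphisms of `T` through a summand
    -- that is not isomorphic to `T` annihilate `p • a`, as this summand is indecomposable.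
    obtain ⟨g, rfl⟩ := h.exists_hom_from F hF x hx
    rw [← h₃ (g.1 (p • a)), map_sum]
    refine Finset.sum_eq_zero fun k _ => ?_
    by_cases hk : Iso (X k) T
    · obtain ⟨w, hw⟩ := h.exists_map_eq (homMap T (α ⟨k, hk⟩) (homMap T (q k) g))
        (Submodule.map_mono inf_le_left h.smul_mem_socleTrace.1)
      change (α ⟨k, hk⟩).1 ((q k).1 (g.1 (p • a))) = w • p • a at hw
      rw [← hβα ⟨k, hk⟩ ((q k).1 (g.1 (p • a))), hw, map_smul, map_smul, map_smul]
      have h0 := hf ⟨k, hk⟩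
      rw [h0, smul_zero]
    · by_contra hne
      obtain ⟨s, hs, -⟩ := h.isAutomorphism
        (homMap T f (homMap T (i k) (homMap T (q k) g))) hne
      refine hk ((hind k).iso_of_retract (homMap _ f (i k)) (homMap _ (q k) (homMap _ g s))
        fun t => ?_)
      exact LinearMap.congr_fun (congrArg Subtype.val hs) t
  · refine ⟨∑ k, c k • homMap F (α k) (q k), fun l => ?_⟩
    rw [Submodule.coe_sum, LinearMap.sum_apply, Finset.sum_eq_single l]
    · change c l • (α l).1 ((q l).1 ((i l).1 ((β l).1 (p • a)))) = _
      rw [h₁, hαβ]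
    · intro k _ hkl
      change c k • (α k).1 ((q k).1 ((i l).1 ((β l).1 (p • a)))) = 0
      rw [h₂ _ _ (fun h' => hkl (Subtype.ext h')), map_zero, smul_zero]
    · exact fun hl => absurd (Finset.mem_univ l) hl

end IsModel

end Emb
end Klein

/-! ### Passing to the subfactor -/

namespace Klein
namespace Emb

section Subfactor

variable {R : Type u} [CommRing R] {p : R}

/-- The kernel of the map between the images of `p ^ (m - 1) B` that compute the Klein diagrams with
subscripts `r` and `r - 1` is the socle quotient. -/
theorem map_inf_sup_eq_socleQuotient (m r : ℕ) (X : Emb R) :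
    (powMul p (m - 1) ⊤ ⊓ (powMul p 1 (X.A ⊓ powMul p (r - 1) ⊤) ⊔ powMul p m ⊤)).map
      (powMul p 1 (X.A ⊓ powMul p r ⊤) ⊔ powMul p m ⊤).mkQ = socleQuotient p m r X := by
  have hle : powMul p m (⊤ : Submodule R X.B) ≤ powMul p (m - 1) ⊤ :=
    powMul_top_antitone (Nat.sub_le m 1)
  apply le_antisymm
  · rintro _ ⟨z, ⟨hz, hz'⟩, rfl⟩
    obtain ⟨y, hy, y', hy', rfl⟩ := Submodule.mem_sup.1 hz'
    refine ⟨y, ⟨hy, ?_⟩, ?_⟩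
    · rw [← add_sub_cancel_right y y']
      exact sub_mem hz (hle hy')
    · rw [map_add, left_eq_add]
      exact (Submodule.Quotient.mk_eq_zero _).2 (Submodule.mem_sup_right hy')
  · exact Submodule.map_mono (le_inf inf_le_right (inf_le_left.trans le_sup_left))

theorem powMul_le_powMul_sub (E : Emb R) (ℓ i : ℕ) : powMul p ℓ E.A ≤ powMul p (ℓ - i) E.A := by
  rintro _ ⟨x, hx, rfl⟩
  refine ⟨p ^ (ℓ - (ℓ - i)) • x, E.A.smul_mem _ hx, ?_⟩
  rw [LinearMap.lsmul_apply, LinearMap.lsmul_apply, smul_smul, ← pow_add,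
    Nat.add_sub_cancel' (Nat.sub_le ℓ i)]

theorem inS2_subfactor {E : Emb R} (hE : E.InS p) {ℓ : ℕ} (hℓ : 2 ≤ ℓ) :
    (E.subfactor p ℓ).InS2 p := by
  obtain ⟨h, n, hn⟩ := hE
  refine ⟨⟨h.of_surjective (Submodule.mkQ_surjective _), n, fun x => ?_⟩, ?_⟩
  · obtain ⟨x, rfl⟩ := Submodule.mkQ_surjective _ x
    rw [← map_smul, hn, map_zero]
  · rintro _ ⟨_, ⟨a, ha, rfl⟩, rfl⟩
    rw [← map_smul]
    refine (Submodule.Quotient.mk_eq_zero _).2 ⟨a, ha, ?_⟩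
    rw [LinearMap.lsmul_apply, LinearMap.lsmul_apply, smul_smul, ← pow_add, Nat.add_sub_cancel' hℓ]

/-- The quotient of `B` that defines the Klein diagram of `E` for the entry `ℓ` is the quotient of
the ambient module of the subfactor that defines its Klein diagram for the entry `2`. -/
theorem ker_factor_subfactor (E : Emb R) (ℓ r : ℕ) :
    LinearMap.ker (Submodule.factor (show powMul p ℓ E.A ≤
      powMul p ℓ E.A ⊔ powMul p 1 (powMul p (ℓ - 2) E.A ⊓ powMul p r ⊤) from le_sup_left)) =
      powMul p 1 ((E.subfactor p ℓ).A ⊓ powMul p r ⊤) := by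
  have hmkQ : ∀ x y : E.B, (powMul p ℓ E.A).mkQ x = (powMul p ℓ E.A).mkQ y ↔
      x - y ∈ powMul p ℓ E.A := fun x y => Submodule.Quotient.eq _
  apply le_antisymm
  · intro x hx
    obtain ⟨b, rfl⟩ := Submodule.mkQ_surjective _ x
    have hb := (Submodule.Quotient.mk_eq_zero _).1 (LinearMap.mem_ker.1 hx)
    obtain ⟨u, hu, _, ⟨x, ⟨hxA, c, -, rfl⟩, rfl⟩, rfl⟩ := Submodule.mem_sup.1 hb
    refine ⟨(powMul p ℓ E.A).mkQ (p ^ r • c), ⟨⟨_, hxA, rfl⟩, (powMul p ℓ E.A).mkQ c, trivial,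
      (map_smul _ _ _).symm⟩, ?_⟩
    rw [LinearMap.lsmul_apply, ← map_smul, hmkQ, ← neg_mem_iff, neg_sub]
    change u + p ^ 1 • p ^ r • c - p ^ 1 • p ^ r • c ∈ _
    rwa [add_sub_cancel_right]
  · rintro _ ⟨ξ, ⟨⟨x, hx, rfl⟩, c, -, hc⟩, rfl⟩
    obtain ⟨c, rfl⟩ := Submodule.mkQ_surjective _ c
    rw [LinearMap.lsmul_apply, ← map_smul, hmkQ, ← neg_mem_iff, neg_sub] at hc
    rw [LinearMap.lsmul_apply, ← map_smul, LinearMap.mem_ker]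
    refine (Submodule.Quotient.mk_eq_zero _).2 (Submodule.mem_sup.2
      ⟨p ^ 1 • (x - p ^ r • c), Submodule.smul_mem _ _ hc, p ^ 1 • p ^ r • c,
        ⟨p ^ r • c, ⟨?_, c, trivial, rfl⟩, rfl⟩, ?_⟩)
    · rw [← sub_sub_cancel x (p ^ r • c)]
      exact sub_mem hx (powMul_le_powMul_sub E ℓ 2 hc)
    · rw [smul_sub, sub_add_cancel]
      rfl

/-- The Klein count is the length of the socle quotient of the subfactor. -/
theorem length_socleQuotient_subfactor [IsDomain R] [IsPrincipalIdealRing R] (hp : Prime p)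
    {E : Emb R} (hE : E.InS p) {ℓ m r : ℕ} (hℓ : 2 ≤ ℓ) (hm : 1 ≤ m) :
    Module.length R (socleQuotient p m r (E.subfactor p ℓ)) = E.kleinCount p ℓ r m := by
  have hF := (inS2_subfactor hE hℓ).1.1
  have hc : ∀ s, (conjType p
      (E.B ⧸ (powMul p ℓ E.A ⊔ powMul p 1 (powMul p (ℓ - 2) E.A ⊓ powMul p s ⊤))) m : ℕ∞) =
      Module.length R ((powMul p (m - 1) (⊤ : Submodule R (E.subfactor p ℓ).B)).map
        (powMul p 1 ((E.subfactor p ℓ).A ⊓ powMul p s ⊤) ⊔ powMul p m ⊤).mkQ) := fun s => by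
    rw [conjType_eq_length hp hF (Submodule.factor_surjective
      (show powMul p ℓ E.A ≤ powMul p ℓ E.A ⊔ powMul p 1 (powMul p (ℓ - 2) E.A ⊓ powMul p s ⊤)
        from le_sup_left)) hm, ker_factor_subfactor]
  have hle : powMul p 1 ((E.subfactor p ℓ).A ⊓ powMul p r ⊤) ⊔ powMul p m ⊤ ≤
      powMul p 1 ((E.subfactor p ℓ).A ⊓ powMul p (r - 1) ⊤) ⊔ powMul p m ⊤ := by
    exact sup_le_sup_right (Submodule.map_mono (inf_le_inf_left _
      (powMul_top_antitone (Nat.sub_le r 1)))) _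
  have key := length_map_mkQ (powMul p (m - 1) (⊤ : Submodule R (E.subfactor p ℓ).B)) hle
  rw [map_inf_sup_eq_socleQuotient m r, ← hc r, ← hc (r - 1)] at key
  have hcount : E.kleinCount p ℓ r m = _ := ncard_row_diff hm
  rw [hcount]
  generalize Module.length R (socleQuotient p m r (E.subfactor p ℓ)) = K at key ⊢
  lift K to ℕ using fun h => by
    rw [h, top_add] at key
    exact ENat.natCast_ne_top _ key
  norm_cast at key ⊢
  omega

/-- For `T` in `S_2`, the morphisms from `E` to the lifting of `T` are the morphisms to `T` from
the subfactor of `E`. -/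
def subfactorHom (E : Emb R) (ℓ : ℕ) (T : Emb R) :
    Hom (E.subfactor p ℓ) T →ₗ[R] Hom E (lift p (ℓ - 2) T) where
  toFun f := ⟨f.1 ∘ₗ (powMul p ℓ E.A).mkQ, fun a ha => by
    change p ^ (ℓ - 2) • f.1 ((powMul p ℓ E.A).mkQ a) ∈ T.A
    rw [← map_smul, ← map_smul]
    exact f.2 _ ⟨_, ⟨a, ha, rfl⟩, rfl⟩⟩
  map_add' _ _ := rfl
  map_smul' _ _ := rfl

theorem subfactorHom_bijective (E : Emb R) {ℓ : ℕ} (hℓ : 2 ≤ ℓ) {T : Emb R} (hT : T.InS2 p) :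
    Function.Bijective (subfactorHom (p := p) E ℓ T) := by
  constructor
  · intro f g hfg
    refine Subtype.ext (LinearMap.ext fun x => ?_)
    obtain ⟨x, rfl⟩ := Submodule.mkQ_surjective _ x
    exact LinearMap.congr_fun (congrArg Subtype.val hfg) x
  · intro g
    have hg : ∀ a ∈ E.A, p ^ (ℓ - 2) • g.1 a ∈ T.A := fun a ha => g.2 a ha
    have hker : powMul p ℓ E.A ≤ LinearMap.ker g.1 := by
      rintro _ ⟨a, ha, rfl⟩
      have h := hT.2 _ (hg a ha)
      rwa [smul_smul, ← pow_add, Nat.add_sub_cancel' hℓ, ← map_smul] at h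
    refine ⟨⟨(powMul p ℓ E.A).liftQ g.1 hker, ?_⟩, Subtype.ext (LinearMap.ext fun x => rfl)⟩
    rintro _ ⟨_, ⟨a, ha, rfl⟩, rfl⟩
    change g.1 (p ^ (ℓ - 2) • a) ∈ T.A
    rw [map_smul]
    exact hg a ha

/-- The defect of the lifted morphism on `E` is the defect of `v` on the subfactor. -/
theorem map_range_homMap (E : Emb R) {ℓ : ℕ} (hℓ : 2 ≤ ℓ) {Y T : Emb R} (hY : Y.InS2 p)
    (v : Hom Y T) :
    (LinearMap.range (homMap (E.subfactor p ℓ) v)).map (subfactorHom E ℓ T) =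
      LinearMap.range (homMap E (liftHom p (ℓ - 2) v)) := by
  have hcomm : ∀ g, subfactorHom E ℓ T (homMap (E.subfactor p ℓ) v g) =
      homMap E (liftHom p (ℓ - 2) v) (subfactorHom E ℓ Y g) := fun g => rfl
  apply le_antisymm
  · rintro _ ⟨_, ⟨g, rfl⟩, rfl⟩
    exact ⟨_, (hcomm g).symm⟩
  · rintro _ ⟨g, rfl⟩
    obtain ⟨g, rfl⟩ := (subfactorHom_bijective E hℓ hY).2 g
    exact ⟨_, ⟨g, rfl⟩, hcomm g⟩

end Subfactor

end Emb
end Klein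

theorem theorem2 {R : Type u} [CommRing R] [IsDomain R] [IsPrincipalIdealRing R]
    (p : R) (hp : Prime p) (E : Klein.Emb R) (hE : E.InS p)
    (ℓ m r : ℕ) (hℓ : 2 ≤ ℓ) (hℓr : ℓ ≤ r + 1) (hrm : r + 1 ≤ m) :
    (E.subfactor p ℓ).HasMultiplicity (Klein.Emb.bipicket p m r) (E.kleinCount p ℓ r m) ∧
      (∃ (Y : Klein.Emb R) (v : Klein.Emb.Hom Y (Klein.Emb.bipicket p m r)),
        Klein.Emb.IsSinkMap p v) ∧
      ∀ (Y : Klein.Emb R) (v : Klein.Emb.Hom Y (Klein.Emb.bipicket p m r)),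
        Klein.Emb.IsSinkMap p v →
          Klein.HasResidueDim p (E.Defect (Klein.Emb.liftHom p (ℓ - 2) v))
            (E.kleinCount p ℓ r m) := by
  obtain ⟨a, h⟩ := Klein.Emb.exists_isModel_bipicket hp (m := m) (r := r) (by omega) hrm
  have hF := Klein.Emb.inS2_subfactor hE hℓ
  obtain ⟨e⟩ := h.nonempty_equiv_of_length_socleQuotient hp hF
    (Klein.Emb.length_socleQuotient_subfactor hp hE hℓ (by omega))
  refine ⟨⟨Klein.Emb.exists_isDecomposition hF.1.1, fun n X hX => ?_⟩, h.exists_isSinkMap hp,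
    fun Y v hv => ?_⟩
  · classical
    obtain ⟨e'⟩ := h.nonempty_equiv_of_isDecomposition hp hF hX
    have hl := (e.symm.trans e').length_eq
    rw [Klein.length_residueRing_pi hp, Klein.length_residueRing_pi hp, Fintype.card_fin] at hl
    rw [← Nat.card_coe_set_eq, Set.coe_ofPred, Nat.card_eq_fintype_card]
    exact_mod_cast hl.symm
  · have e₁ := Submodule.Quotient.equiv _ _
      (LinearEquiv.ofBijective _ (Klein.Emb.subfactorHom_bijective E hℓ hv.target_mem))
      (Klein.Emb.map_range_homMap E hℓ hv.source_mem v)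
    rw [h.range_homMap hF hv] at e₁
    have := Klein.hasResidueDim_of_equiv hp (e₁.symm.trans e)
    rwa [Fintype.card_fin] at this
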